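/- Let $G=(V,E)$ be a finite graph with complementary graph $\bar G=(V,\bar E)$, let $s\in\mathbb N$ with $s\le|\bar E|$, and let $\alpha\in(0,2)$, $\beta>0$. Put $D_s(G)=\{y\in\{0,1\}^{\bar E}: \sum_e y_e\le s\}$, $D'_s(G)=\{y\in[0,1]^{\bar E}:\sum_e y_e\le s\}$, $\mathcal P=\Delta\times D'_s(G)$ with $\Delta\subset\mathbb R^V$ the standard simplex, and, for $z=(x,y)\in\mathbb R^V\times\mathbb R^{\bar E}$, $$h(z)=x^{\top}(A_G+A(y))x+\tfrac{\alpha}{2}\|x\|^2+\tfrac{\beta}{2}\|y\|^2,$$ where $A_G$ is the adjacency matrix of $G$, $A(y)_{ij}=y_{ij}$ if $\{i,j\}\in\bar E$ and $A(y)_{ij}=0$ otherwise. For $y\in D_s(G)$ let $G(y)$ be the graph obtained from $G$ by adding the edges $\{i,j\}\in\bar E$ with $y_{ij}=1$, and for nonempty $C\subseteq V$ let $x^{(C)}=\frac1{|C|}\sum_{i\in C}e_i$. Let $z_k=(x_k,y_k)$, $k\ge0$, be a sequence generated by the Frank-Wolfe method with in face directions (FDFW) for the maximization of $h$ over $\mathcal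 P$: $z_0\in\mathcal P$; given $z_k$, choose $s_k\in\arg\max_{w\in\mathcal P}\langle\nabla h(z_k),w\rangle$. If $z_k$ is stationary (that is, $\langle\nabla h(z_k),w-z_k\rangle\le0$ for all $w\in\mathcal P$) the method stops, and we put $z_j=z_k$ for $j\ge k$. Otherwise choose $v_k\in\arg\min_{w\in\mathcal F(z_k)}\langle\nabla h(z_k),w\rangle$, where $\mathcal F(z_k)$ is the minimal face of $\mathcal P$ containing $z_k$, and let $d_k=s_k-z_k$ if $\langle\nabla h(z_k),s_k-z_k\rangle\ge\langle\nabla h(z_k),z_k-v_k\rangle$ and $d_k=z_k-v_k$ otherwise; then $z_{k+1}=z_k+\alpha_kd_k$ with $\alpha_k\in(0,\alpha_k^{\max}]$, where $\alpha_k^{\max}$ is the largest $t\ge 0$ with $z_k+td_k\in\mathcal P$. Assume that there are constants $c,\rho>0$ such that for every $k$ with $z_k$ not stationary, with $\bar\alpha_k=\min\left(\alpha_k^{\max},\,c\,\frac{\langle\nabla h(z_k),d_k\rangle}{\|d_k\|^2}\right)$, $$\alpha_k\ge\bar\alpha_k\quad\text{(S1)},\qquad h(z_k+\alpha_kd_k)-h(z_k)\ge\rho\,\bar\alpha_k\,\langle\nabla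 h(z_k),d_k\rangle\quad\text{(S2)}.$$ Suppose that some limit point $p$ of $(z_k)$ is a strict local maximizer of $h$ over $\mathcal P$. Then $p=(x^{(C)},y^{(p)})$ with $y^{(p)}\in D_s(G)$ and $C$ a nonempty maximal clique of $G(y^{(p)})$; the whole sequence $(z_k)$ converges to $p$; and for all sufficiently large $k$ we have $\operatorname{supp}(x_k)\subseteq C$ and $y_k=y^{(p)}$. -/

import Mathlib

open Set Filter Topology

noncomputable section

namespace DefectiveClique

/-! ### The Frank-Wolfe method with in face directions on a polytope -/

section FrankWolfe

variable {E : Type*} [NormedAddCommGroup E] [InnerProductSpace ℝ E] [CompleteSpace E]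

/-- First order stationarity for the problem of maximizing `f` over `Q`. -/
def IsStationary (f : E → ℝ) (Q : Set E) (w : E) : Prop :=
  w ∈ Q ∧ ∀ y ∈ Q, inner ℝ (gradient f w) (y - w) ≤ 0

/-- A face of a convex set: a convex extreme subset. -/
def IsFace (Q F : Set E) : Prop := Convex ℝ F ∧ IsExtreme ℝ Q F

/-- The minimal face of `Q` containing `w`, i.e. the intersection of all faces containing `w`. -/
def minimalFace (Q : Set E) (w : E) : Set E := ⋂₀ {F | IsFace Q F ∧ w ∈ F}

/-- The maximal feasible stepsize from `w` along `d`. For compact `Q`, `w ∈ Q` and `d ≠ 0`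
the set is nonempty and compact, so that the supremum is attained. -/
def maxStep (Q : Set E) (w d : E) : ℝ := sSup {t : ℝ | 0 ≤ t ∧ w + t • d ∈ Q}

/-- `w` is a sequence generated by the Frank-Wolfe method with in face directions (FDFW) for
maximizing `f` over `Q`. Here `s k` is the Frank-Wolfe point, `v k` the in face point, `d k` the
selected direction and `a k` the stepsize. When the method stops at a stationary point `w k`,
the sequence is continued as a constant sequence, and `v j`, `d j`, `a j` are irrelevant for
`j ≥ k`. -/
structure IsFDFW (f : E → ℝ) (Q : Set E) (w s v d : ℕ → E) (a : ℕ → ℝ) : Prop where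
  init : w 0 ∈ Q
  fw_mem : ∀ k, s k ∈ Q
  fw_max : ∀ k, IsMaxOn (fun y => inner ℝ (gradient f (w k)) y) Q (s k)
  halt : ∀ k, IsStationary f Q (w k) → w (k + 1) = w k
  face_mem : ∀ k, ¬ IsStationary f Q (w k) → v k ∈ minimalFace Q (w k)
  face_min : ∀ k, ¬ IsStationary f Q (w k) →
    IsMinOn (fun y => inner ℝ (gradient f (w k)) y) (minimalFace Q (w k)) (v k)
  dir_fw : ∀ k, ¬ IsStationary f Q (w k) →
    inner ℝ (gradient f (w k)) (w k - v k) ≤ inner ℝ (gradient f (w k)) (s k - w k) →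
      d k = s k - w k
  dir_face : ∀ k, ¬ IsStationary f Q (w k) →
    inner ℝ (gradient f (w k)) (s k - w k) < inner ℝ (gradient f (w k)) (w k - v k) →
      d k = w k - v k
  step_pos : ∀ k, ¬ IsStationary f Q (w k) → 0 < a k
  step_le : ∀ k, ¬ IsStationary f Q (w k) → a k ≤ maxStep Q (w k) (d k)
  update : ∀ k, ¬ IsStationary f Q (w k) → w (k + 1) = w k + a k • d k

/-- The lower bound `min (α_max, c ⟨∇ f(w), d⟩ / ‖d‖²)` for the stepsize. -/
def stepBound (f : E → ℝ) (Q : Set E) (c : ℝ) (w d : E) : ℝ :=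
  min (maxStep Q w d) (c * (inner ℝ (gradient f w) d / ‖d‖ ^ 2))

/-- Condition (S1) with constant `c`, at every iteration that is performed. -/
def StepCondition (f : E → ℝ) (Q : Set E) (c : ℝ) (w d : ℕ → E) (a : ℕ → ℝ) : Prop :=
  ∀ k, ¬ IsStationary f Q (w k) → stepBound f Q c (w k) (d k) ≤ a k

/-- Condition (S2) with constants `c`, `ρ`, at every iteration that is performed. -/
def IncreaseCondition (f : E → ℝ) (Q : Set E) (c ρ : ℝ) (w d : ℕ → E) (a : ℕ → ℝ) : Prop :=
  ∀ k, ¬ IsStationary f Q (w k) →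
    ρ * stepBound f Q c (w k) (d k) * inner ℝ (gradient f (w k)) (d k) ≤
      f (w k + a k • d k) - f (w k)

/-- `p` is a strict local maximizer of `f` over `Q`. -/
def IsStrictLocalMaximizer (f : E → ℝ) (Q : Set E) (p : E) : Prop :=
  p ∈ Q ∧ ∀ᶠ z in 𝓝[Q] p, z ≠ p → f z < f p

end FrankWolfe

/-! ### The regularized maximum `s`-defective clique formulation -/

section Formulation

variable {V : Type*} [Fintype V] [DecidableEq V] (G : SimpleGraph V) [DecidableRel G.Adj]

/-- The space of pairs `z = (x, y)`, with `x` indexed by the vertices of `G` and `y` by the edges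
of the complementary graph, with its Euclidean structure. -/
abbrev Space : Type _ := WithLp 2 (EuclideanSpace ℝ V × EuclideanSpace ℝ Gᶜ.edgeSet)

/-- The set `D_s(G)` of at most `s` fake edges. -/
def fakeEdges (s : ℕ) : Set (EuclideanSpace ℝ Gᶜ.edgeSet) :=
  {y | (∀ e, y e = 0 ∨ y e = 1) ∧ ∑ e, y e ≤ s}

/-- The continuous relaxation `D'_s(G)`. -/
def relaxedFakeEdges (s : ℕ) : Set (EuclideanSpace ℝ Gᶜ.edgeSet) :=
  {y | (∀ e, 0 ≤ y e ∧ y e ≤ 1) ∧ ∑ e, y e ≤ s}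

/-- The feasible polytope, product of the standard simplex and `D'_s(G)`. -/
def feasibleSet (s : ℕ) : Set (Space G) :=
  {z | z.fst.ofLp ∈ stdSimplex ℝ V ∧ z.snd ∈ relaxedFakeEdges G s}

/-- The induced adjacency matrix `A(y)`. -/
def inducedMatrix (y : EuclideanSpace ℝ Gᶜ.edgeSet) : Matrix V V ℝ :=
  Matrix.of fun i j => if h : s(i, j) ∈ Gᶜ.edgeSet then y ⟨s(i, j), h⟩ else 0

/-- The graph `G(y)`: the edges `{i, j}` of the complementary graph with `y_ij = 1` are added
to `G`. -/
def augmentedGraph (y : EuclideanSpace ℝ Gᶜ.edgeSet) : SimpleGraph V :=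
  G ⊔ SimpleGraph.fromEdgeSet {e | ∃ h : e ∈ Gᶜ.edgeSet, y ⟨e, h⟩ = 1}

/-- The objective `h_G(x, y) = xᵀ (A_G + A(y)) x + α / 2 ‖x‖² + β / 2 ‖y‖²`. -/
def objective (α β : ℝ) (z : Space G) : ℝ :=
  z.fst.ofLp ⬝ᵥ (G.adjMatrix ℝ + inducedMatrix G z.snd).mulVec z.fst.ofLp
    + α / 2 * ‖z.fst‖ ^ 2 + β / 2 * ‖z.snd‖ ^ 2

end Formulation

/-- The characteristic vector `x^(C) = |C|⁻¹ ∑_{i ∈ C} e_i`. -/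
def charVector {V : Type*} [DecidableEq V] (C : Finset V) : EuclideanSpace ℝ V :=
  (C.card : ℝ)⁻¹ • ∑ i ∈ C, EuclideanSpace.single i (1 : ℝ)

end DefectiveClique

end

noncomputable section

namespace DefectiveClique

/-! ### Faces, feasible steps and active constraints of polyhedra. -/

section Polytope

variable {E : Type*} [NormedAddCommGroup E] [InnerProductSpace ℝ E]

/-! Structure of `p`. Along directions moving only `x` or only `y` the objective is exactly
quadratic, and at a strict local maximizer no two-sided feasible direction has nonnegative curvature
(`not_two_sided`). Curvature is positive along edge directions, so `y` is binary; it is positive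
along `e_i - e_j` for nonadjacent `i`, `j`, so `supp x` is a clique of `G(y)`. Over any clique
containing the support, the objective with `y` fixed is a constant minus `(1 - α/2)‖x‖²`, so `x` is
the barycenter of that clique; this also forces the support to be a maximal clique.

Identification of the face. Let `F` be the face on which the linearization at `p` attains its
maximum; it consists of the points with `supp x ⊆ C` and `y = y^(p)` (`mem_optimalFace_iff`). From
every feasible point off `F` some direction of a fixed finite set, strictly ascending at `p`, is
feasible, and near `p` its opposite is feasible with a uniform step (`isAscentSystem`). So near `p`,
off `F`, the in face gap is bounded below, while the Frank-Wolfe gap tends to `0` because `p` is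
stationary. The method therefore takes in face directions. Their maximal steps are short, since `p`
maximizes its own linearization, so (S1) makes the step maximal. Each such step activates a new
constraint (`card_inactive_lt`), so boundedly many short steps lead to `F`.

Convergence. Near `p` the method cannot leave `F`, where the objective equals `h(p) - (1 - α/2)‖z -
p‖²`. By (S2) the objective never decreases, so the distance to `p` never increases; as `p` is a
limit point, the whole sequence converges. -/

theorem minimalFace_subset {Q F : Set E} {w : E} (hF : IsFace Q F) (hw : w ∈ F) :
    minimalFace Q w ⊆ F :=
  sInter_subset_of_mem ⟨hF, hw⟩

theorem isFace_self {Q : Set E} (hQ : Convex ℝ Q) : IsFace Q Q :=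
  ⟨hQ, IsExtreme.refl ℝ Q⟩

/-- The point `w` is interior to the segment from `v` to `w + t(w - v)`, and a face containing an
interior point of a segment of `Q` contains its endpoints. -/
theorem mem_minimalFace_of_add_smul_mem {Q : Set E} {w v : E} {t : ℝ} (hv : v ∈ Q) (ht : 0 < t)
    (h : w + t • (w - v) ∈ Q) : v ∈ minimalFace Q w := by
  rintro F ⟨⟨-, hF⟩, hwF⟩
  refine hF.left_mem_of_mem_openSegment hv h hwF
    ⟨t / (1 + t), 1 / (1 + t), by positivity, by positivity, by field_simp; ring, ?_⟩
  have h1 : 1 / (1 + t) * t = t / (1 + t) := by ring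
  have h2 : t / (1 + t) + 1 / (1 + t) = 1 := by field_simp; ring
  rw [smul_add, smul_smul, h1]
  calc _ = (t / (1 + t) + 1 / (1 + t)) • w := by module
    _ = w := by rw [h2, one_smul]

theorem isFace_setOf_eq {Q : Set E} (hQ : Convex ℝ Q) (l : E →L[ℝ] ℝ) {b : ℝ}
    (hl : ∀ w ∈ Q, l w ≤ b) : IsFace Q {w ∈ Q | l w = b} := by
  refine ⟨?_, ⟨fun w hw => hw.1, ?_⟩⟩
  · rintro x ⟨hx, hx'⟩ y ⟨hy, hy'⟩ r r' hr hr' hrr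
    refine ⟨hQ hx hy hr hr' hrr, ?_⟩
    rw [map_add, map_smul, map_smul, hx', hy', ← add_smul, hrr, one_smul]
  · rintro x hx y hy w ⟨hw, hw'⟩ ⟨r, r', hr, hr', hrr, rfl⟩
    refine ⟨hx, le_antisymm (hl x hx) ?_⟩
    rw [map_add, map_smul, map_smul, smul_eq_mul, smul_eq_mul] at hw'
    have h2 := hl y hy
    by_contra! hlt
    have : r * l x + r' * l y < r * b + r' * b := by
      have := mul_lt_mul_of_pos_left hlt hr
      have := mul_le_mul_of_nonneg_left h2 hr'.le
      linarith
    rw [hw', ← add_mul, hrr, one_mul] at this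
    exact lt_irrefl _ this

theorem exists_dist_le {E : Type*} [NormedAddCommGroup E] {Q : Set E} (hQ : Bornology.IsBounded Q) :
    ∃ R : ℝ, 0 < R ∧ ∀ x ∈ Q, ∀ y ∈ Q, ‖x - y‖ ≤ R := by
  obtain ⟨R, hR⟩ := Metric.isBounded_iff.1 hQ
  refine ⟨max R 1, by positivity, fun x hx y hy => ?_⟩
  rw [← dist_eq_norm]
  exact (hR hx hy).trans (le_max_left _ _)

theorem maxStep_nonneg (Q : Set E) (w d : E) : 0 ≤ maxStep Q w d :=
  Real.sSup_nonneg fun _ ht => ht.1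

theorem bddAbove_steps {Q : Set E} (hQ : Bornology.IsBounded Q) {w d : E} (hw : w ∈ Q)
    (hd : d ≠ 0) : BddAbove {t : ℝ | 0 ≤ t ∧ w + t • d ∈ Q} := by
  obtain ⟨R, -, hR⟩ := exists_dist_le hQ
  refine ⟨R / ‖d‖, fun t ht => ?_⟩
  rw [le_div_iff₀ (norm_pos_iff.2 hd)]
  have := hR _ ht.2 _ hw
  rwa [add_sub_cancel_left, norm_smul, Real.norm_of_nonneg ht.1] at this

theorem add_maxStep_smul_mem {Q : Set E} (hQ : IsCompact Q) {w d : E} (hw : w ∈ Q)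
    (hd : d ≠ 0) : w + maxStep Q w d • d ∈ Q := by
  have hcl : IsClosed {t : ℝ | 0 ≤ t ∧ w + t • d ∈ Q} :=
    (isClosed_le continuous_const continuous_id).inter
      (hQ.isClosed.preimage (f := fun t : ℝ => w + t • d) (by fun_prop))
  exact (hcl.csSup_mem ⟨0, le_rfl, by simpa using hw⟩ (bddAbove_steps hQ.isBounded hw hd)).2

theorem add_smul_mem_of_le {Q : Set E} (hQ : Convex ℝ Q) {w d : E} {t r : ℝ} (hw : w ∈ Q)
    (h : w + t • d ∈ Q) (hr : 0 ≤ r) (hrt : r ≤ t) : w + r • d ∈ Q := by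
  rcases hr.eq_or_lt with rfl | hr
  · simpa using hw
  have ht : 0 < t := hr.trans_le hrt
  have := hQ.add_smul_mem hw h (t := r / t) ⟨by positivity, (div_le_one ht).2 hrt⟩
  rwa [smul_smul, div_mul_cancel₀ _ ht.ne'] at this

theorem add_smul_mem_of_le_maxStep {Q : Set E} (hQ : IsCompact Q) (hQc : Convex ℝ Q) {w d : E}
    {r : ℝ} (hw : w ∈ Q) (hr : 0 ≤ r) (hrt : r ≤ maxStep Q w d) : w + r • d ∈ Q := by
  by_cases hd : d = 0
  · simpa [hd] using hw
  · exact add_smul_mem_of_le hQc hw (add_maxStep_smul_mem hQ hw hd) hr hrt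

variable {ι : Type*}

/-- The polyhedron cut out by the inequalities `l i w ≤ b i`. -/
def polyhedron (l : ι → E →L[ℝ] ℝ) (b : ι → ℝ) : Set E := {w | ∀ i, l i w ≤ b i}

theorem convex_polyhedron (l : ι → E →L[ℝ] ℝ) (b : ι → ℝ) : Convex ℝ (polyhedron l b) := by
  rw [polyhedron, ofPred_forall]
  exact convex_iInter fun i => convex_halfSpace_le (l i).isLinear (b i)

variable [Fintype ι]

open Classical in
/-- The constraints of a polyhedron that are inactive at `w`. -/
def inactive (l : ι → E →L[ℝ] ℝ) (b : ι → ℝ) (w : E) : Finset ι := {i | l i w < b i}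

/-- Constraints active at `w` cut out a face containing `v`, so they are constant along `w - v` and
stay active. If no other constraint became active, the step could be prolonged beyond the maximal
one. -/
theorem card_inactive_lt {l : ι → E →L[ℝ] ℝ} {b : ι → ℝ} (hQ : IsCompact (polyhedron l b))
    {w v : E} (hw : w ∈ polyhedron l b) (hv : v ∈ minimalFace (polyhedron l b) w)
    (hne : w - v ≠ 0) :
    (inactive l b (w + maxStep (polyhedron l b) w (w - v) • (w - v))).card
      < (inactive l b w).card := by
  set Q := polyhedron l b with hQdef
  set d := w - v with hd
  set m := maxStep Q w d with hm
  have hmem := add_maxStep_smul_mem hQ hw hne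
  have hact : ∀ i, l i w = b i → l i d = 0 := fun i hi => by
    have := minimalFace_subset (isFace_setOf_eq (convex_polyhedron l b) (l i)
      (fun x hx => hx i)) ⟨hw, hi⟩ hv
    rw [hd, map_sub, hi, this.2, sub_self]
  refine Finset.card_lt_card ⟨fun i hi => ?_, fun hsub => ?_⟩
  · simp only [inactive, Finset.mem_filter, Finset.mem_univ, true_and] at hi ⊢
    refine lt_of_le_of_ne (hw i) fun h => ?_
    rw [map_add, map_smul, hact i h, h] at hi
    simp at hi
  · have hev : ∀ᶠ t in 𝓝 m, ∀ i, l i (w + t • d) ≤ b i := by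
      refine eventually_all.2 fun i => ?_
      by_cases hi : l i w = b i
      · exact Eventually.of_forall fun t => by simp [hact i hi, hi]
      · have h1 : i ∈ inactive l b (w + m • d) :=
          hsub (by simpa [inactive] using lt_of_le_of_ne (hw i) hi)
        simp only [inactive, Finset.mem_filter, Finset.mem_univ, true_and] at h1
        have hc : Continuous fun t : ℝ => l i (w + t • d) := by fun_prop
        exact (hc.continuousAt.eventually_lt continuousAt_const h1).mono fun _ h => h.le
    obtain ⟨t, htm, ht⟩ := ((hev.filter_mono nhdsWithin_le_nhds).and
      (self_mem_nhdsWithin (a := m) (s := Ioi m))).exists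
    have : t ≤ m := le_csSup (bddAbove_steps hQ.isBounded hw hne)
      ⟨(maxStep_nonneg Q w d).trans ht.le, htm⟩
    exact absurd ht (not_lt.2 this)

end Polytope

/-! ### Local behaviour of FDFW near a stationary point. -/

section FrankWolfe

variable {E : Type*} [NormedAddCommGroup E] [InnerProductSpace ℝ E] [CompleteSpace E]
  {f : E → ℝ} {Q : Set E} {w s v d : ℕ → E} {a : ℕ → ℝ}

theorem stepBound_nonneg {c : ℝ} (hc : 0 ≤ c) {x e : E} (h : 0 ≤ inner ℝ (gradient f x) e) :
    0 ≤ stepBound f Q c x e :=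
  le_min (maxStep_nonneg _ _ _) (by positivity)

namespace IsFDFW

variable (hw : IsFDFW f Q w s v d a)

include hw

theorem succ_mem (hQ : IsCompact Q) (hQc : Convex ℝ Q) {k : ℕ} (hk : w k ∈ Q) :
    w (k + 1) ∈ Q := by
  by_cases h : IsStationary f Q (w k)
  · rwa [hw.halt k h]
  · rw [hw.update k h]
    exact add_smul_mem_of_le_maxStep hQ hQc hk (hw.step_pos k h).le (hw.step_le k h)

theorem mem (hQ : IsCompact Q) (hQc : Convex ℝ Q) (k : ℕ) : w k ∈ Q := by
  induction k with
  | zero => exact hw.init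
  | succ k ih => exact hw.succ_mem hQ hQc ih

theorem inner_fw_nonneg {k : ℕ} (hk : w k ∈ Q) :
    0 ≤ inner ℝ (gradient f (w k)) (s k - w k) := by
  rw [inner_sub_right, sub_nonneg]
  exact hw.fw_max k hk

theorem inner_dir_nonneg {k : ℕ} (hk : w k ∈ Q) (h : ¬ IsStationary f Q (w k)) :
    0 ≤ inner ℝ (gradient f (w k)) (d k) := by
  rcases le_or_gt (inner ℝ (gradient f (w k)) (w k - v k))
    (inner ℝ (gradient f (w k)) (s k - w k)) with h1 | h1
  · rw [hw.dir_fw k h h1]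
    exact hw.inner_fw_nonneg hk
  · rw [hw.dir_face k h h1]
    exact (hw.inner_fw_nonneg hk).trans h1.le

theorem le_succ {c ρ : ℝ} (hc : 0 ≤ c) (hρ : 0 ≤ ρ) (hS : IncreaseCondition f Q c ρ w d a)
    {k : ℕ} (hk : w k ∈ Q) : f (w k) ≤ f (w (k + 1)) := by
  by_cases h : IsStationary f Q (w k)
  · rw [hw.halt k h]
  · have h1 := hS k h
    have h2 := hw.inner_dir_nonneg hk h
    have h3 := stepBound_nonneg (Q := Q) hc h2
    rw [hw.update k h]
    have : 0 ≤ ρ * stepBound f Q c (w k) (d k) * inner ℝ (gradient f (w k)) (d k) := by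
      positivity
    linarith

end IsFDFW

/-- The Frank-Wolfe gap is nonpositive at `p`; boundedness of `Q` makes continuity uniform in `y`.
-/
theorem eventually_inner_fw_lt (hQ : Bornology.IsBounded Q) {p : E}
    (hf : Continuous (gradient f)) (hopt : ∀ y ∈ Q, inner ℝ (gradient f p) (y - p) ≤ 0) {ε : ℝ}
    (hε : 0 < ε) :
    ∀ᶠ x in 𝓝[Q] p, ∀ y ∈ Q, inner ℝ (gradient f x) (y - x) < ε := by
  obtain ⟨R, hR, hRQ⟩ := exists_dist_le hQ
  have hc : Continuous fun x => ‖gradient f x - gradient f p‖ * R + ‖gradient f p‖ * ‖p - x‖ := by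
    fun_prop
  have h1 := (hc.tendsto p).mono_left (nhdsWithin_le_nhds (s := Q))
  simp only [sub_self, norm_zero, zero_mul, mul_zero, add_zero] at h1
  filter_upwards [h1.eventually_lt_const hε, self_mem_nhdsWithin] with x hx hxQ y hy
  have e : inner ℝ (gradient f x) (y - x) = inner ℝ (gradient f x - gradient f p) (y - x)
      + inner ℝ (gradient f p) (y - p) + inner ℝ (gradient f p) (p - x) := by
    simp only [inner_sub_left, inner_sub_right]; ring
  have i1 := real_inner_le_norm (gradient f x - gradient f p) (y - x)
  have i2 := real_inner_le_norm (gradient f p) (p - x)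
  have i3 := mul_le_mul_of_nonneg_left (hRQ y hy x hxQ) (norm_nonneg (gradient f x - gradient f p))
  linarith [hopt y hy]

/-- The linearization at `p` grows along `x - y` with slope at least `δ/2`, yet on `Q` it never
exceeds its value at `p`, to which its value at `x` is close. This leaves room only for a short
step. -/
theorem eventually_maxStep_lt (hQ : Bornology.IsBounded Q) {p : E}
    (hf : Continuous (gradient f)) (hopt : ∀ y ∈ Q, inner ℝ (gradient f p) (y - p) ≤ 0) {ε δ : ℝ}
    (hε : 0 < ε) (hδ : 0 < δ) :
    ∀ᶠ x in 𝓝[Q] p, ∀ y ∈ Q, δ ≤ inner ℝ (gradient f x) (x - y) → maxStep Q x (x - y) < ε := by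
  obtain ⟨R, hR, hRQ⟩ := exists_dist_le hQ
  have hc : Continuous fun x => ‖gradient f x - gradient f p‖ * R := by fun_prop
  have h1 := (hc.tendsto p).mono_left (nhdsWithin_le_nhds (s := Q))
  have hc2 : Continuous fun x => inner ℝ (gradient f p) (p - x) := by fun_prop
  have h2 := (hc2.tendsto p).mono_left (nhdsWithin_le_nhds (s := Q))
  simp only [sub_self, norm_zero, zero_mul, inner_zero_right] at h1 h2
  filter_upwards [h1.eventually_lt_const (half_pos hδ),
    h2.eventually_lt_const (show 0 < ε / 2 * (δ / 2) by positivity), self_mem_nhdsWithin]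
    with x hx hx2 hxQ y hy hxy
  have hd : δ / 2 ≤ inner ℝ (gradient f p) (x - y) := by
    have e : inner ℝ (gradient f x) (x - y) = inner ℝ (gradient f x - gradient f p) (x - y)
        + inner ℝ (gradient f p) (x - y) := by
      simp only [inner_sub_left]; ring
    have i1 := real_inner_le_norm (gradient f x - gradient f p) (x - y)
    have i3 := mul_le_mul_of_nonneg_left (hRQ x hxQ y hy)
      (norm_nonneg (gradient f x - gradient f p))
    linarith
  have hne : {t : ℝ | 0 ≤ t ∧ x + t • (x - y) ∈ Q}.Nonempty := ⟨0, le_rfl, by simpa using hxQ⟩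
  refine (csSup_le hne fun t ht => ?_).trans_lt (half_lt_self hε)
  have h3 := hopt _ ht.2
  rw [show x + t • (x - y) - p = t • (x - y) - (p - x) by abel, inner_sub_right,
    inner_smul_right] at h3
  have h4 := mul_le_mul_of_nonneg_left hd ht.1
  by_contra! hlt
  have h5 := mul_le_mul_of_nonneg_right hlt.le (half_pos hδ).le
  linarith

/-- Exposed face of `Q` on which the linearization of `f` at `p` is constant. -/
def optimalFace (f : E → ℝ) (Q : Set E) (p : E) : Set E :=
  {y ∈ Q | inner ℝ (gradient f p) y = inner ℝ (gradient f p) p}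

theorem isFace_optimalFace (hQ : Convex ℝ Q) {p : E}
    (hopt : ∀ y ∈ Q, inner ℝ (gradient f p) (y - p) ≤ 0) : IsFace Q (optimalFace f Q p) := by
  refine isFace_setOf_eq hQ (innerSL ℝ (gradient f p)) fun y hy => ?_
  have := hopt y hy
  rwa [inner_sub_right, sub_nonpos] at this

/-- A finite set `D` of directions of strict ascent at `p` which is feasible at every point of `Q`
outside the optimal face, and whose opposites are feasible near `p` with a uniform stepsize. -/
structure IsAscentSystem (f : E → ℝ) (Q : Set E) (p : E) (D : Set E) : Prop where
  finite : D.Finite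
  pos : ∀ u ∈ D, 0 < inner ℝ (gradient f p) u
  feasible : ∀ y ∈ Q, y ∉ optimalFace f Q p → ∃ u ∈ D, ∃ t : ℝ, 0 < t ∧ y + t • u ∈ Q
  opposite : ∀ u ∈ D, ∃ τ : ℝ, 0 < τ ∧ ∀ᶠ y in 𝓝[Q] p, y - τ • u ∈ Q

namespace IsAscentSystem

variable {p : E} {D : Set E} (hD : IsAscentSystem f Q p D)

include hD

theorem eventually_pos (hf : Continuous (gradient f)) :
    ∀ᶠ x in 𝓝[Q] p, ∀ u ∈ D, 0 < inner ℝ (gradient f x) u := by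
  refine (eventually_all_finite hD.finite).2 fun u hu => ?_
  have hc : Continuous fun x => inner ℝ (gradient f x) u := by fun_prop
  exact ((hc.tendsto p).mono_left nhdsWithin_le_nhds).eventually_const_lt (hD.pos u hu)

theorem eventually_not_isStationary (hf : Continuous (gradient f)) :
    ∀ᶠ x in 𝓝[Q] p, x ∉ optimalFace f Q p → ¬ IsStationary f Q x := by
  filter_upwards [hD.eventually_pos hf, self_mem_nhdsWithin] with x hx hxQ hxF hst
  obtain ⟨u, hu, t, ht, hut⟩ := hD.feasible x hxQ hxF
  have h := hst.2 _ hut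
  rw [add_sub_cancel_left, inner_smul_right] at h
  exact absurd h (not_le.2 (mul_pos ht (hx u hu)))

theorem eventually_mem_optimalFace_of_isMaxOn (hf : Continuous (gradient f)) :
    ∀ᶠ x in 𝓝[Q] p, ∀ y ∈ Q, IsMaxOn (fun z => inner ℝ (gradient f x) z) Q y →
      y ∈ optimalFace f Q p := by
  filter_upwards [hD.eventually_pos hf] with x hx y hy hmax
  by_contra hyF
  obtain ⟨u, hu, t, ht, hut⟩ := hD.feasible y hy hyF
  have h : inner ℝ (gradient f x) (y + t • u) ≤ inner ℝ (gradient f x) y := hmax hut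
  rw [inner_add_right, inner_smul_right] at h
  have := mul_pos ht (hx u hu)
  linarith

/-- This bounds the in face gap from below. Off the optimal face both `x + t u` and `x - τ u` are
feasible for some `u ∈ D`, so `x - τ u` lies in the minimal face of `x`; its gain is about `τ⟨∇f(p),
u⟩`, and finiteness of `D` makes the bound uniform. -/
theorem exists_inner_sub_ge (hf : Continuous (gradient f)) :
    ∃ δ : ℝ, 0 < δ ∧ ∀ᶠ x in 𝓝[Q] p, x ∉ optimalFace f Q p →
      ∃ y ∈ minimalFace Q x, δ ≤ inner ℝ (gradient f x) (x - y) := by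
  have h1 : ∃ δ : ℝ, 0 < δ ∧ ∀ u ∈ D, ∃ τ : ℝ, 0 < τ ∧
      ∀ᶠ y in 𝓝[Q] p, y - τ • u ∈ Q ∧ δ ≤ inner ℝ (gradient f y) (τ • u) := by
    have h2 : ∀ u ∈ D, ∃ δ : ℝ, 0 < δ ∧ ∃ τ : ℝ, 0 < τ ∧
        ∀ᶠ y in 𝓝[Q] p, y - τ • u ∈ Q ∧ δ ≤ inner ℝ (gradient f y) (τ • u) := by
      intro u hu
      obtain ⟨τ, hτ, h⟩ := hD.opposite u hu
      have hpos := mul_pos hτ (hD.pos u hu)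
      refine ⟨τ * inner ℝ (gradient f p) u / 2, by positivity, τ, hτ, h.and ?_⟩
      have hc : Continuous fun x => inner ℝ (gradient f x) (τ • u) := by fun_prop
      refine (((hc.tendsto p).mono_left nhdsWithin_le_nhds).eventually_const_lt ?_).mono
        fun _ h => h.le
      rw [inner_smul_right]
      linarith
    choose! δ hδ τ hτ h using h2
    rcases D.eq_empty_or_nonempty with rfl | hne
    -- For empty `D` every positive constant works.
    · exact ⟨1, one_pos, by simp⟩
    obtain ⟨u₀, hu₀, hmin⟩ := hD.finite.exists_minimalFor δ D hne
    refine ⟨δ u₀, hδ u₀ hu₀, fun u hu => ⟨τ u, hτ u hu, (h u hu).mono fun y hy => ⟨hy.1, ?_⟩⟩⟩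
    exact (le_of_not_gt fun hlt => not_lt.2 (hmin hu hlt.le) hlt).trans hy.2
  obtain ⟨δ, hδ, h⟩ := h1
  choose! τ hτ h using h
  refine ⟨δ, hδ, ?_⟩
  filter_upwards [(eventually_all_finite hD.finite).2 h, self_mem_nhdsWithin] with x hx hxQ hxF
  obtain ⟨u, hu, t, ht, hut⟩ := hD.feasible x hxQ hxF
  refine ⟨x - τ u • u, mem_minimalFace_of_add_smul_mem (t := t / τ u) (hx u hu).1
    (div_pos ht (hτ u hu)) ?_, ?_⟩
  · rwa [sub_sub_cancel, smul_smul, div_mul_cancel₀ _ (hτ u hu).ne']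
  · rw [sub_sub_cancel]
    exact (hx u hu).2

end IsAscentSystem

/-- Near `p` and outside the optimal face, FDFW performs maximal in face steps of small length. -/
theorem IsFDFW.eventually_maximal_step (hw : IsFDFW f Q w s v d a) (hQ : IsCompact Q)
    (hQc : Convex ℝ Q) (hf : Continuous (gradient f)) {p : E}
    (hopt : ∀ y ∈ Q, inner ℝ (gradient f p) (y - p) ≤ 0) {D : Set E}
    (hD : IsAscentSystem f Q p D) {c : ℝ} (hc : 0 < c) (hS : StepCondition f Q c w d a)
    {ε : ℝ} (hε : 0 < ε) :
    ∀ᶠ x in 𝓝[Q] p, x ∉ optimalFace f Q p → ∀ k, w k = x →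
      v k ∈ minimalFace Q x ∧ x - v k ≠ 0 ∧
        w (k + 1) = x + maxStep Q x (x - v k) • (x - v k) ∧ dist (w (k + 1)) x < ε := by
  obtain ⟨R, hR, hRQ⟩ := exists_dist_le hQ.isBounded
  obtain ⟨δ, hδ, h1⟩ := hD.exists_inner_sub_ge hf
  -- With `R` bounding the diameter, a maximal step below `ε / R` moves less than `ε`, and one below
  -- `c δ / R²` attains the minimum in `stepBound`.
  filter_upwards [h1, hD.eventually_not_isStationary hf,
    eventually_inner_fw_lt hQ.isBounded hf hopt hδ,
    eventually_maxStep_lt hQ.isBounded hf hopt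
      (show 0 < min (ε / R) (c * (δ / R ^ 2)) by positivity) hδ,
    self_mem_nhdsWithin] with x hx hst hfw hstep hxQ hxF k hk
  obtain ⟨y, hy, hyδ⟩ := hx hxF
  have hst := hst hxF
  rw [← hk] at hst
  have hvm := hw.face_mem k hst
  have hvQ : v k ∈ Q := minimalFace_subset (isFace_self hQc) (hk ▸ hxQ) hvm
  have hmin : inner ℝ (gradient f (w k)) (v k) ≤ inner ℝ (gradient f (w k)) y :=
    hw.face_min k hst (by rwa [hk])
  have hvδ : δ ≤ inner ℝ (gradient f x) (x - v k) := by
    rw [hk] at hmin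
    rw [inner_sub_right] at hyδ ⊢
    linarith
  have hd : d k = x - v k := by
    have := hw.dir_face k hst (by
      rw [hk]
      exact (hfw _ (hw.fw_mem k)).trans_le hvδ)
    rwa [hk] at this
  have hm := hstep _ hvQ hvδ
  have hne : x - v k ≠ 0 := fun h => by
    rw [h, inner_zero_right] at hvδ
    linarith
  have hnp := norm_pos_iff.2 hne
  have ha : a k = maxStep Q x (x - v k) := by
    refine le_antisymm ?_ ?_
    · have := hw.step_le k hst
      rwa [hd, hk] at this
    · have := hS k hst
      rw [hd, hk, stepBound, min_eq_left] at this
      · exact this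
      · refine (hm.le.trans (min_le_right _ _)).trans ?_
        gcongr
        · exact hδ.le.trans hvδ
        · exact hRQ _ hxQ _ hvQ
  have hup := hw.update k hst
  rw [ha, hd, hk] at hup
  refine ⟨hk ▸ hvm, hne, hup, ?_⟩
  rw [hup, dist_eq_norm, add_sub_cancel_left, norm_smul, Real.norm_of_nonneg (maxStep_nonneg _ _ _)]
  calc _ ≤ maxStep Q x (x - v k) * R := by
        gcongr
        · exact maxStep_nonneg _ _ _
        · exact hRQ _ hxQ _ hvQ
    _ < ε / R * R := by
        gcongr
        exact hm.trans_le (min_le_left _ _)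
    _ = ε := div_mul_cancel₀ _ hR.ne'

/-- From points near `p`, FDFW reaches the optimal face without moving far away. -/
theorem IsFDFW.eventually_reaches_optimalFace {ι : Type*} [Fintype ι] {l : ι → E →L[ℝ] ℝ}
    {b : ι → ℝ} (hw : IsFDFW f (polyhedron l b) w s v d a) (hQ : IsCompact (polyhedron l b))
    (hf : Continuous (gradient f)) {p : E}
    (hopt : ∀ y ∈ polyhedron l b, inner ℝ (gradient f p) (y - p) ≤ 0) {D : Set E}
    (hD : IsAscentSystem f (polyhedron l b) p D) {c : ℝ} (hc : 0 < c)
    (hS : StepCondition f (polyhedron l b) c w d a) {r : ℝ} (hr : 0 < r) (n : ℕ) :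
    ∃ η : ℝ, 0 < η ∧ ∀ k, dist (w k) p < η → (inactive l b (w k)).card < n →
      ∃ k', dist (w k') p < r ∧ w k' ∈ optimalFace f (polyhedron l b) p := by
  have hQc := convex_polyhedron l b
  induction n with
  | zero => exact ⟨1, one_pos, fun k _ h => absurd h (Nat.not_lt_zero _)⟩
  | succ n ih =>
    obtain ⟨η, hη, h⟩ := ih
    have h1 := hw.eventually_maximal_step hQ hQc hf hopt hD hc hS (half_pos hη)
    obtain ⟨η', hη', h2⟩ := Metric.eventually_nhds_iff.1 (eventually_nhdsWithin_iff.1 h1)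
    -- The radius `r` serves iterates already on the face; `η'` guarantees a maximal step shorter
    -- than `η / 2`, which from distance `η / 2` keeps the next iterate within `η`.
    refine ⟨min r (min η' (η / 2)), by positivity, fun k hk hcard => ?_⟩
    obtain ⟨hkr, hk2⟩ := lt_min_iff.1 hk
    obtain ⟨hkη', hkη⟩ := lt_min_iff.1 hk2
    by_cases hF : w k ∈ optimalFace f (polyhedron l b) p
    · exact ⟨k, hkr, hF⟩
    obtain ⟨hvm, hne, hup, hdist⟩ := h2 hkη' (hw.mem hQ hQc k) hF k rfl
    refine h (k + 1) ?_ ?_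
    · linarith [dist_triangle (w (k + 1)) (w k) p]
    · have := card_inactive_lt hQ (hw.mem hQ hQc k) hvm hne
      rw [← hup] at this
      omega

/-- Near `p`, FDFW does not leave the optimal face. -/
theorem IsFDFW.eventually_succ_mem_optimalFace (hw : IsFDFW f Q w s v d a) (hQ : IsCompact Q)
    (hQc : Convex ℝ Q) (hf : Continuous (gradient f)) {p : E}
    (hopt : ∀ y ∈ Q, inner ℝ (gradient f p) (y - p) ≤ 0) {D : Set E}
    (hD : IsAscentSystem f Q p D) :
    ∀ᶠ x in 𝓝[Q] p, x ∈ optimalFace f Q p → ∀ k, w k = x → w (k + 1) ∈ optimalFace f Q p := by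
  filter_upwards [hD.eventually_mem_optimalFace_of_isMaxOn hf] with x hx hxF k hk
  by_cases hst : IsStationary f Q (w k)
  · rwa [hw.halt k hst, hk]
  have hs := hx (s k) (hw.fw_mem k) (hk ▸ hw.fw_max k)
  have hv : v k ∈ optimalFace f Q p :=
    minimalFace_subset (isFace_optimalFace hQc hopt) (hk ▸ hxF) (hw.face_mem k hst)
  refine ⟨hw.mem hQ hQc _, ?_⟩
  have hd : inner ℝ (gradient f p) (d k) = 0 := by
    rcases le_or_gt (inner ℝ (gradient f (w k)) (w k - v k))
      (inner ℝ (gradient f (w k)) (s k - w k)) with h1 | h1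
    · rw [hw.dir_fw k hst h1, inner_sub_right, hs.2, hk, hxF.2, sub_self]
    · rw [hw.dir_face k hst h1, inner_sub_right, hv.2, hk, hxF.2, sub_self]
  rw [hw.update k hst, inner_add_right, inner_smul_right, hd, mul_zero, add_zero, hk, hxF.2]

/-- Once an iterate lies on the optimal face near `p`, `hconc` turns monotonicity of `f` into
monotonicity of the distance to `p`; this keeps all later iterates in the neighbourhood where the
face is not left. -/
theorem IsFDFW.tendsto_and_eventually_mem_optimalFace {ι : Type*} [Fintype ι]
    {l : ι → E →L[ℝ] ℝ} {b : ι → ℝ} (hw : IsFDFW f (polyhedron l b) w s v d a)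
    (hQ : IsCompact (polyhedron l b)) (hf : Continuous (gradient f)) {p : E}
    (hopt : ∀ y ∈ polyhedron l b, inner ℝ (gradient f p) (y - p) ≤ 0) {D : Set E}
    (hD : IsAscentSystem f (polyhedron l b) p D) {c ρ : ℝ} (hc : 0 < c) (hρ : 0 < ρ)
    (hS1 : StepCondition f (polyhedron l b) c w d a)
    (hS2 : IncreaseCondition f (polyhedron l b) c ρ w d a)
    {κ : ℝ} (hκ : 0 < κ)
    (hconc : ∀ y ∈ optimalFace f (polyhedron l b) p, f y = f p - κ * ‖y - p‖ ^ 2)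
    (hcl : MapClusterPt p atTop w) :
    Tendsto w atTop (𝓝 p) ∧ ∀ᶠ k in atTop, w k ∈ optimalFace f (polyhedron l b) p := by
  have hQc := convex_polyhedron l b
  obtain ⟨r, hr, h1⟩ := Metric.eventually_nhds_iff.1 (eventually_nhdsWithin_iff.1
    (hw.eventually_succ_mem_optimalFace hQ hQc hf hopt hD))
  -- The bound `card ι + 1` exceeds the number of inactive constraints at any point.
  obtain ⟨η, hη, h2⟩ := hw.eventually_reaches_optimalFace hQ hf hopt hD hc hS1 hr
    (Fintype.card ι + 1)
  have hfreq := fun (ε : ℝ) (hε : 0 < ε) =>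
    hcl.frequently (Metric.ball_mem_nhds p hε)
  obtain ⟨k, hk⟩ := (hfreq η hη).exists
  obtain ⟨N, hN, hNF⟩ := h2 k hk (Nat.lt_succ_of_le (Finset.card_le_univ _))
  have hstep : ∀ m, dist (w m) p < r → w m ∈ optimalFace f (polyhedron l b) p →
      dist (w (m + 1)) p ≤ dist (w m) p ∧ w (m + 1) ∈ optimalFace f (polyhedron l b) p := by
    intro m hm hmF
    have hF := h1 hm hmF.1 hmF m rfl
    refine ⟨?_, hF⟩
    have hle := hw.le_succ hc.le hρ.le hS2 hmF.1
    rw [hconc _ hmF, hconc _ hF, ← dist_eq_norm, ← dist_eq_norm] at hle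
    refine le_of_sq_le_sq ?_ dist_nonneg
    exact le_of_mul_le_mul_left (by linarith) hκ
  have hall : ∀ m, N ≤ m → dist (w m) p < r ∧ w m ∈ optimalFace f (polyhedron l b) p := by
    intro m hm
    induction m, hm using Nat.le_induction with
    | base => exact ⟨hN, hNF⟩
    | succ m _ ih =>
      obtain ⟨h, h'⟩ := hstep m ih.1 ih.2
      exact ⟨h.trans_lt ih.1, h'⟩
  refine ⟨Metric.tendsto_atTop.2 fun ε hε => ?_, eventually_atTop.2 ⟨N, fun m hm => (hall m hm).2⟩⟩
  obtain ⟨M, hM, hMε⟩ := frequently_atTop.1 (hfreq ε hε) N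
  refine ⟨M, fun m hm => ?_⟩
  induction m, hm using Nat.le_induction with
  | base => exact hMε
  | succ m hm ih =>
    obtain ⟨h, h'⟩ := hall m (hM.trans hm)
    exact (hstep m h h').1.trans_lt ih

end FrankWolfe

/-! ### First and second order conditions along lines. -/

section StrictLocalMaximizer

variable {E : Type*} [NormedAddCommGroup E] [InnerProductSpace ℝ E]
  {f : E → ℝ} {Q : Set E} {p u : E} {L q : ℝ}

/-- The increment is `t (L + t q)`, so `L + t q < 0` for small `t > 0`. Letting `t → 0` gives the
first claim; for `q ≥ 0` a single such `t` gives the second. -/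
theorem IsStrictLocalMaximizer.expansion (hmax : IsStrictLocalMaximizer f Q p) (hQ : Convex ℝ Q)
    (hu : u ≠ 0) {ε : ℝ} (hε : 0 < ε) (h : p + ε • u ∈ Q)
    (hexp : ∀ t : ℝ, f (p + t • u) = f p + t * L + t ^ 2 * q) : L ≤ 0 ∧ (0 ≤ q → L < 0) := by
  have hcont : Tendsto (fun t : ℝ => p + t • u) (𝓝[>] 0) (𝓝[Q] p) := by
    refine tendsto_nhdsWithin_iff.2 ⟨?_, ?_⟩
    · have hc : Continuous fun t : ℝ => p + t • u := by fun_prop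
      simpa using (hc.tendsto 0).mono_left nhdsWithin_le_nhds
    · filter_upwards [Ioo_mem_nhdsGT hε] with t ht
      exact add_smul_mem_of_le hQ hmax.1 h ht.1.le ht.2.le
  have hneg : ∀ᶠ t in 𝓝[>] (0 : ℝ), L + t * q < 0 := by
    filter_upwards [hcont.eventually hmax.2, self_mem_nhdsWithin] with t ht (ht0 : 0 < t)
    have h1 := ht (by simp [ht0.ne', hu])
    rw [hexp] at h1
    by_contra! h2
    nlinarith [mul_nonneg ht0.le h2]
  refine ⟨?_, fun hq => ?_⟩
  · have hc : Continuous fun t : ℝ => L + t * q := by fun_prop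
    have h1 := (hc.tendsto 0).mono_left (nhdsWithin_le_nhds (s := Ioi 0))
    rw [zero_mul, add_zero] at h1
    exact le_of_tendsto h1 (hneg.mono fun _ h => h.le)
  · obtain ⟨t, ht, ht0⟩ := (hneg.and self_mem_nhdsWithin).exists
    have := mul_nonneg (le_of_lt ht0) hq
    linarith

theorem IsStrictLocalMaximizer.not_two_sided (hmax : IsStrictLocalMaximizer f Q p)
    (hQ : Convex ℝ Q) (hu : u ≠ 0) {ε : ℝ} (hε : 0 < ε) (h : p + ε • u ∈ Q)
    (h' : p + (-ε) • u ∈ Q) (hq : 0 ≤ q)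
    (hexp : ∀ t : ℝ, f (p + t • u) = f p + t * L + t ^ 2 * q) : False := by
  have h1 := (hmax.expansion hQ hu hε h hexp).2 hq
  have h2 := (hmax.expansion (L := -L) hQ (neg_ne_zero.2 hu) hε (by rwa [smul_neg, ← neg_smul])
    (fun t => by rw [smul_neg, ← neg_smul, hexp]; ring)).2 hq
  linarith

theorem inner_gradient_eq [CompleteSpace E] (hf : DifferentiableAt ℝ f p)
    (hexp : ∀ t : ℝ, f (p + t • u) = f p + t * L + t ^ 2 * q) :
    inner ℝ (gradient f p) u = L := by
  have h1 : HasDerivAt (fun t : ℝ => f (p + t • u)) (fderiv ℝ f p u) 0 :=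
    hf.hasFDerivAt.hasLineDerivAt u
  have h2 : HasDerivAt (fun t : ℝ => f p + t * L + t ^ 2 * q) L 0 := by
    have := (((hasDerivAt_id (0 : ℝ)).mul_const L).const_add (f p)).add
      (((hasDerivAt_id (0 : ℝ)).pow 2).mul_const q)
    simpa [Pi.add_def] using this
  rw [funext hexp] at h1
  rw [gradient, InnerProductSpace.toDual_symm_apply]
  exact h1.unique h2

theorem continuous_gradient [CompleteSpace E] (hf : ContDiff ℝ 1 f) : Continuous (gradient f) :=
  (InnerProductSpace.toDual ℝ E).symm.continuous.comp (hf.continuous_fderiv one_ne_zero)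

theorem IsStrictLocalMaximizer.inner_gradient_nonpos [CompleteSpace E]
    (hmax : IsStrictLocalMaximizer f Q p) (hQ : Convex ℝ Q) (hf : DifferentiableAt ℝ f p) :
    ∀ y ∈ Q, inner ℝ (gradient f p) (y - p) ≤ 0 := by
  intro y hy
  rw [gradient, InnerProductSpace.toDual_symm_apply]
  refine IsLocalMaxOn.hasFDerivWithinAt_nonpos (s := Q) (a := p) ?_
    hf.hasFDerivAt.hasFDerivWithinAt (sub_mem_posTangentConeAt_of_segment_subset
      (hQ.segment_subset hmax.1 hy))
  filter_upwards [hmax.2] with x hx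
  by_cases h : x = p
  · rw [h]
  · exact (hx h).le

end StrictLocalMaximizer

/-! ### The feasible polytope and expansions of the objective. -/

section Formulation

set_option linter.unusedSectionVars false

variable {V : Type*} [Fintype V] [DecidableEq V] (G : SimpleGraph V) [DecidableRel G.Adj]

variable {G} in
theorem mem_feasibleSet {s : ℕ} {z : Space G} :
    z ∈ feasibleSet G s ↔ (∀ i, 0 ≤ z.fst i) ∧ ∑ i, z.fst i = 1 ∧
      (∀ e, 0 ≤ z.snd e ∧ z.snd e ≤ 1) ∧ ∑ e, z.snd e ≤ s := by
  simp only [feasibleSet, stdSimplex, relaxedFakeEdges, mem_ofPred_eq, and_assoc]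

/-- The coordinate of `z = (x, y)` at a vertex. -/
def fstCoord (i : V) : Space G →L[ℝ] ℝ := (EuclideanSpace.proj i).comp (WithLp.fstL 2 ℝ _ _)

/-- The coordinate of `z = (x, y)` at an edge of the complementary graph. -/
def sndCoord (e : Gᶜ.edgeSet) : Space G →L[ℝ] ℝ :=
  (EuclideanSpace.proj e).comp (WithLp.sndL 2 ℝ _ _)

theorem fstCoord_apply (i : V) (z : Space G) : fstCoord G i z = z.fst i := rfl

theorem sndCoord_apply (e : Gᶜ.edgeSet) (z : Space G) : sndCoord G e z = z.snd e := rfl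

/-- The linear functionals in the inequality description of the feasible set. -/
def feasibleFunctional :
    V ⊕ Unit ⊕ Unit ⊕ Gᶜ.edgeSet ⊕ Gᶜ.edgeSet ⊕ Unit → Space G →L[ℝ] ℝ :=
  Sum.elim (fun i => -fstCoord G i) <| Sum.elim (fun _ => ∑ i, fstCoord G i) <|
    Sum.elim (fun _ => -∑ i, fstCoord G i) <| Sum.elim (fun e => -sndCoord G e) <|
      Sum.elim (fun e => sndCoord G e) fun _ => ∑ e, sndCoord G e

/-- The bounds in the inequality description of the feasible set. -/
def feasibleBound (s : ℕ) : V ⊕ Unit ⊕ Unit ⊕ Gᶜ.edgeSet ⊕ Gᶜ.edgeSet ⊕ Unit → ℝ :=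
  Sum.elim (fun _ => 0) <| Sum.elim (fun _ => 1) <| Sum.elim (fun _ => -1) <|
    Sum.elim (fun _ => 0) <| Sum.elim (fun _ => 1) fun _ => s

theorem feasibleSet_eq_polyhedron (s : ℕ) :
    feasibleSet G s = polyhedron (feasibleFunctional G) (feasibleBound G s) := by
  ext z
  simp only [mem_feasibleSet, polyhedron, mem_ofPred_eq, Sum.forall, feasibleFunctional,
    feasibleBound, Sum.elim_inl, Sum.elim_inr, neg_apply, sum_apply, fstCoord_apply, sndCoord_apply, neg_nonpos, forall_const,
    neg_le_neg_iff, forall_and]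
  rw [eq_iff_le_not_lt, not_lt]
  simp only [and_assoc]

theorem convex_feasibleSet (s : ℕ) : Convex ℝ (feasibleSet G s) := by
  rw [feasibleSet_eq_polyhedron]
  exact convex_polyhedron _ _

theorem norm_sq_eq_dotProduct {ι : Type*} [Fintype ι] (x : EuclideanSpace ℝ ι) :
    ‖x‖ ^ 2 = x.ofLp ⬝ᵥ x.ofLp := by
  rw [EuclideanSpace.real_norm_sq_eq]
  simp [dotProduct, sq]

theorem isCompact_feasibleSet (s : ℕ) : IsCompact (feasibleSet G s) := by
  refine Metric.isCompact_of_isClosed_isBounded ?_ ?_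
  · rw [feasibleSet_eq_polyhedron, polyhedron, ofPred_forall]
    exact isClosed_iInter fun i => isClosed_le (feasibleFunctional G i).continuous
      continuous_const
  · refine (Metric.isBounded_closedBall (x := (0 : Space G))
      (r := Fintype.card V + Fintype.card Gᶜ.edgeSet + 1)).subset fun z hz => ?_
    obtain ⟨h1, h2, h3, -⟩ := mem_feasibleSet.1 hz
    rw [mem_closedBall_zero_iff]
    have hx : ‖z.fst‖ ^ 2 ≤ Fintype.card V := by
      rw [EuclideanSpace.real_norm_sq_eq]
      refine (Finset.sum_le_card_nsmul _ _ 1 fun i _ => ?_).trans (by simp)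
      have : z.fst i ≤ 1 := h2 ▸ Finset.single_le_sum (fun j _ => h1 j) (Finset.mem_univ i)
      exact pow_le_one₀ (h1 i) this
    have hy : ‖z.snd‖ ^ 2 ≤ Fintype.card Gᶜ.edgeSet := by
      rw [EuclideanSpace.real_norm_sq_eq]
      exact (Finset.sum_le_card_nsmul _ _ 1 fun e _ => pow_le_one₀ (h3 e).1 (h3 e).2).trans
        (by simp)
    have hz := WithLp.prod_norm_sq_eq_of_L2 z
    nlinarith [norm_nonneg z]

theorem inducedMatrix_add_smul (y v : EuclideanSpace ℝ Gᶜ.edgeSet) (t : ℝ) :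
    inducedMatrix G (y + t • v) = inducedMatrix G y + t • inducedMatrix G v := by
  ext i j
  by_cases h : s(i, j) ∈ Gᶜ.edgeSet <;>
    simp only [inducedMatrix, Matrix.add_apply, Matrix.smul_apply, Matrix.of_apply, h,
      dite_true, dite_false, PiLp.add_apply, PiLp.smul_apply, smul_zero, add_zero]

/-- The matrix `A_G + A(y)`. -/
def totalMatrix (y : EuclideanSpace ℝ Gᶜ.edgeSet) : Matrix V V ℝ :=
  G.adjMatrix ℝ + inducedMatrix G y

theorem isSymm_totalMatrix (y : EuclideanSpace ℝ Gᶜ.edgeSet) : (totalMatrix G y).IsSymm := by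
  refine (G.isSymm_adjMatrix).add ?_
  ext i j
  simp only [inducedMatrix, Matrix.transpose_apply, Matrix.of_apply, Sym2.eq_swap (a := j)]

theorem dotProduct_totalMatrix_comm (y : EuclideanSpace ℝ Gᶜ.edgeSet) (u x : V → ℝ) :
    x ⬝ᵥ (totalMatrix G y).mulVec u = u ⬝ᵥ (totalMatrix G y).mulVec x := by
  rw [Matrix.dotProduct_mulVec, ← Matrix.mulVec_transpose, (isSymm_totalMatrix G y).eq,
    dotProduct_comm]

/-- The direction `(u, 0)`. -/
def fstDir (u : EuclideanSpace ℝ V) : Space G := WithLp.toLp 2 (u, 0)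

/-- The direction `(0, v)`. -/
def sndDir (v : EuclideanSpace ℝ Gᶜ.edgeSet) : Space G := WithLp.toLp 2 (0, v)

theorem fst_add_smul_fstDir (z : Space G) (t : ℝ) (u : EuclideanSpace ℝ V) :
    (z + t • fstDir G u).fst = z.fst + t • u := rfl

theorem snd_add_smul_fstDir (z : Space G) (t : ℝ) (u : EuclideanSpace ℝ V) :
    (z + t • fstDir G u).snd = z.snd := by
  simp [fstDir]

theorem fst_add_smul_sndDir (z : Space G) (t : ℝ) (v : EuclideanSpace ℝ Gᶜ.edgeSet) :
    (z + t • sndDir G v).fst = z.fst := by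
  simp [sndDir]

theorem snd_add_smul_sndDir (z : Space G) (t : ℝ) (v : EuclideanSpace ℝ Gᶜ.edgeSet) :
    (z + t • sndDir G v).snd = z.snd + t • v := rfl

theorem fstDir_ne_zero {u : EuclideanSpace ℝ V} (hu : u ≠ 0) : fstDir G u ≠ 0 := fun h =>
  hu (congrArg WithLp.fst h)

theorem sndDir_ne_zero {v : EuclideanSpace ℝ Gᶜ.edgeSet} (hv : v ≠ 0) : sndDir G v ≠ 0 :=
  fun h => hv (congrArg WithLp.snd h)

variable (α β : ℝ)

theorem objective_eq (z : Space G) : objective G α β z =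
    z.fst.ofLp ⬝ᵥ (totalMatrix G z.snd).mulVec z.fst.ofLp
      + α / 2 * (z.fst.ofLp ⬝ᵥ z.fst.ofLp) + β / 2 * (z.snd.ofLp ⬝ᵥ z.snd.ofLp) := by
  rw [objective, norm_sq_eq_dotProduct, norm_sq_eq_dotProduct, totalMatrix]

/-- Jointly the objective is cubic, but with `y` fixed it is quadratic, so the expansion is exact.
-/
theorem objective_add_smul_fstDir (z : Space G) (u : EuclideanSpace ℝ V) (t : ℝ) :
    objective G α β (z + t • fstDir G u) = objective G α β z
      + t * (2 * (u.ofLp ⬝ᵥ (totalMatrix G z.snd).mulVec z.fst.ofLp)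
          + α * (u.ofLp ⬝ᵥ z.fst.ofLp))
      + t ^ 2 * (u.ofLp ⬝ᵥ (totalMatrix G z.snd).mulVec u.ofLp + α / 2 * (u.ofLp ⬝ᵥ u.ofLp)) := by
  simp only [objective_eq, fst_add_smul_fstDir, snd_add_smul_fstDir, WithLp.ofLp_add, WithLp.ofLp_smul, Matrix.mulVec_add,
    Matrix.mulVec_smul, dotProduct_add, add_dotProduct, dotProduct_smul, smul_dotProduct,
    smul_eq_mul, dotProduct_totalMatrix_comm G z.snd u.ofLp z.fst.ofLp,
    dotProduct_comm z.fst.ofLp u.ofLp]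
  ring

theorem objective_add_smul_sndDir (z : Space G) (v : EuclideanSpace ℝ Gᶜ.edgeSet) (t : ℝ) :
    objective G α β (z + t • sndDir G v) = objective G α β z
      + t * (z.fst.ofLp ⬝ᵥ (inducedMatrix G v).mulVec z.fst.ofLp + β * (v.ofLp ⬝ᵥ z.snd.ofLp))
      + t ^ 2 * (β / 2 * (v.ofLp ⬝ᵥ v.ofLp)) := by
  simp only [fst_add_smul_sndDir, snd_add_smul_sndDir, inducedMatrix_add_smul,
    totalMatrix, objective_eq, WithLp.ofLp_add, WithLp.ofLp_smul, Matrix.add_mulVec,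
    Matrix.smul_mulVec, dotProduct_add, add_dotProduct, dotProduct_smul, smul_dotProduct,
    smul_eq_mul, dotProduct_comm z.snd.ofLp v.ofLp]
  ring

theorem contDiff_objective : ContDiff ℝ 1 (objective G α β) := by
  have hx : ∀ i, ContDiff ℝ 1 fun z : Space G => z.fst i := fun i => (fstCoord G i).contDiff
  have hy : ∀ e, ContDiff ℝ 1 fun z : Space G => z.snd e := fun e => (sndCoord G e).contDiff
  have hM : ∀ i j, ContDiff ℝ 1 fun z : Space G => inducedMatrix G z.snd i j := fun i j => by
    by_cases h : s(i, j) ∈ Gᶜ.edgeSet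
    · simpa only [inducedMatrix, Matrix.of_apply, h, dite_true] using hy _
    · simpa only [inducedMatrix, Matrix.of_apply, h, dite_false] using contDiff_const
  change ContDiff ℝ 1 fun z => objective G α β z
  simp only [objective, norm_sq_eq_dotProduct, dotProduct, Matrix.mulVec, Matrix.add_apply]
  fun_prop

end Formulation

/-! ### Exchange and coordinate directions. -/

section Directions

set_option linter.unusedSectionVars false

variable {ι : Type*} [Fintype ι] [DecidableEq ι]

/-- The direction `e_i - e_j`. -/
def exchangeDir (i j : ι) : EuclideanSpace ℝ ι :=
  EuclideanSpace.single i 1 - EuclideanSpace.single j 1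

theorem ofLp_exchangeDir (i j : ι) :
    (exchangeDir i j).ofLp = Pi.single i 1 - Pi.single j 1 := rfl

theorem exchangeDir_dotProduct (i j : ι) (x : ι → ℝ) :
    (exchangeDir i j).ofLp ⬝ᵥ x = x i - x j := by
  rw [ofLp_exchangeDir, sub_dotProduct, single_one_dotProduct, single_one_dotProduct]

theorem single_dotProduct_eq (i : ι) (x : ι → ℝ) :
    (EuclideanSpace.single i (1 : ℝ)).ofLp ⬝ᵥ x = x i := by
  rw [PiLp.ofLp_single, single_one_dotProduct]

theorem exchangeDir_dotProduct_self {i j : ι} (h : i ≠ j) :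
    (exchangeDir i j).ofLp ⬝ᵥ (exchangeDir i j).ofLp = 2 := by
  rw [exchangeDir_dotProduct, ofLp_exchangeDir]
  simp [h, h.symm]
  norm_num

theorem exchangeDir_ne_zero {i j : ι} (h : i ≠ j) : exchangeDir i j ≠ 0 := fun h0 => by
  have := exchangeDir_dotProduct_self h
  rw [h0] at this
  simp at this

theorem sum_exchangeDir (i j : ι) : ∑ k, exchangeDir i j k = 0 := by
  simp [ofLp_exchangeDir]

theorem add_smul_exchangeDir_apply {i j : ι} (h : i ≠ j) (x : EuclideanSpace ℝ ι) (t : ℝ) (k : ι) :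
    (x + t • exchangeDir i j) k = if k = i then x i + t else if k = j then x j - t else x k := by
  simp only [PiLp.add_apply, PiLp.smul_apply, ofLp_exchangeDir, Pi.sub_apply, smul_eq_mul]
  by_cases hi : k = i
  · subst hi; simp [h]
  · by_cases hj : k = j
    · subst hj; simp [hi, sub_eq_add_neg]
    · simp [hi, hj]

theorem add_smul_single_apply (i : ι) (x : EuclideanSpace ℝ ι) (t : ℝ) (k : ι) :
    (x + t • EuclideanSpace.single i (1 : ℝ)) k = if k = i then x i + t else x k := by
  by_cases hi : k = i
  · subst hi; simp
  · simp [hi]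

theorem sum_add_smul_exchangeDir (i j : ι) (x : EuclideanSpace ℝ ι) (t : ℝ) :
    ∑ k, (x + t • exchangeDir i j) k = ∑ k, x k := by
  simp only [PiLp.add_apply, PiLp.smul_apply, smul_eq_mul, Finset.sum_add_distrib,
    ← Finset.mul_sum, sum_exchangeDir, mul_zero, add_zero]

theorem sum_add_smul_single (i : ι) (x : EuclideanSpace ℝ ι) (t : ℝ) :
    ∑ k, (x + t • EuclideanSpace.single i (1 : ℝ)) k = ∑ k, x k + t := by
  simp [Finset.sum_add_distrib]

end Directions

/-! ### Barycenters of vertex sets. -/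

section CharVector

set_option linter.unusedSectionVars false

variable {V : Type*} [Fintype V] [DecidableEq V]

theorem charVector_apply (C : Finset V) (i : V) :
    charVector C i = if i ∈ C then (C.card : ℝ)⁻¹ else 0 := by
  simp [charVector, Pi.single_apply]

theorem charVector_nonneg (C : Finset V) (i : V) : 0 ≤ charVector C i := by
  rw [charVector_apply]
  split_ifs <;> positivity

theorem sum_charVector {C : Finset V} (hC : C.Nonempty) : ∑ i, charVector C i = 1 := by
  have : (C.card : ℝ) ≠ 0 := by exact_mod_cast hC.card_pos.ne'
  simp [charVector_apply, Finset.sum_ite_mem, this]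

theorem charVector_dotProduct {C : Finset V} {u : V → ℝ} (hu : Function.support u ⊆ C) :
    (charVector C).ofLp ⬝ᵥ u = (C.card : ℝ)⁻¹ * ∑ i, u i := by
  rw [dotProduct, Finset.mul_sum]
  refine Finset.sum_congr rfl fun i _ => ?_
  rw [charVector_apply]
  split_ifs with h
  · rfl
  · rw [Function.notMem_support.1 fun h' => h (hu h'), mul_zero, mul_zero]

theorem support_charVector (C : Finset V) : Function.support (charVector C).ofLp = C := by
  ext i
  rw [Function.mem_support, charVector_apply]
  by_cases h : i ∈ C
  · have : (C.card : ℝ) ≠ 0 := by exact_mod_cast (Finset.card_pos.2 ⟨i, h⟩).ne'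
    simp [h, Finset.ne_empty_of_mem h]
  · simp [h]

end CharVector

/-! ### Structure of strict local maximizers. -/

section Formulation

set_option linter.unusedSectionVars false

variable {V : Type*} [Fintype V] [DecidableEq V] {G : SimpleGraph V} [DecidableRel G.Adj]

theorem add_smul_fstDir_exchangeDir_mem {s : ℕ} {z : Space G} (hz : z ∈ feasibleSet G s) {i j : V}
    (h : i ≠ j) {t : ℝ} (hi : 0 ≤ z.fst i + t) (hj : 0 ≤ z.fst j - t) :
    z + t • fstDir G (exchangeDir i j) ∈ feasibleSet G s := by
  obtain ⟨h1, h2, h3⟩ := mem_feasibleSet.1 hz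
  refine mem_feasibleSet.2 ⟨fun k => ?_, ?_, by simpa only [snd_add_smul_fstDir] using h3⟩
  · rw [fst_add_smul_fstDir, add_smul_exchangeDir_apply h]
    split_ifs
    exacts [hi, hj, h1 k]
  · rw [fst_add_smul_fstDir, sum_add_smul_exchangeDir, h2]

theorem add_smul_sndDir_exchangeDir_mem {s : ℕ} {z : Space G} (hz : z ∈ feasibleSet G s)
    {e e' : Gᶜ.edgeSet} (h : e ≠ e') {t : ℝ} (h0 : 0 ≤ z.snd e + t) (h1 : z.snd e + t ≤ 1)
    (h0' : 0 ≤ z.snd e' - t) (h1' : z.snd e' - t ≤ 1) :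
    z + t • sndDir G (exchangeDir e e') ∈ feasibleSet G s := by
  obtain ⟨hx, hx', hy, hy'⟩ := mem_feasibleSet.1 hz
  refine mem_feasibleSet.2 ⟨by simpa only [fst_add_smul_sndDir] using hx,
    by simpa only [fst_add_smul_sndDir] using hx', fun k => ?_, ?_⟩
  · rw [snd_add_smul_sndDir, add_smul_exchangeDir_apply h]
    split_ifs
    exacts [⟨h0, h1⟩, ⟨h0', h1'⟩, hy k]
  · rw [snd_add_smul_sndDir, sum_add_smul_exchangeDir]
    exact hy'

theorem add_smul_sndDir_single_mem {s : ℕ} {z : Space G} (hz : z ∈ feasibleSet G s)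
    {e : Gᶜ.edgeSet} {t : ℝ} (h0 : 0 ≤ z.snd e + t) (h1 : z.snd e + t ≤ 1)
    (hs : ∑ k, z.snd k + t ≤ s) :
    z + t • sndDir G (EuclideanSpace.single e 1) ∈ feasibleSet G s := by
  obtain ⟨hx, hx', hy, hy'⟩ := mem_feasibleSet.1 hz
  refine mem_feasibleSet.2 ⟨by simpa only [fst_add_smul_sndDir] using hx,
    by simpa only [fst_add_smul_sndDir] using hx', fun k => ?_, ?_⟩
  · rw [snd_add_smul_sndDir, add_smul_single_apply]
    split_ifs
    exacts [⟨h0, h1⟩, hy k]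
  · rw [snd_add_smul_sndDir, sum_add_smul_single]
    exact hs

theorem augmentedGraph_adj {y : EuclideanSpace ℝ Gᶜ.edgeSet} {i j : V} :
    (augmentedGraph G y).Adj i j ↔ G.Adj i j ∨ ∃ h : s(i, j) ∈ Gᶜ.edgeSet, y ⟨s(i, j), h⟩ = 1 := by
  rw [augmentedGraph, SimpleGraph.sup_adj, SimpleGraph.fromEdgeSet_adj]
  refine or_congr_right ⟨fun h => h.1, fun h => ⟨h, ?_⟩⟩
  obtain ⟨h, -⟩ := h
  exact (SimpleGraph.mem_edgeSet _ |>.1 h).ne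

theorem totalMatrix_apply_of_adj {y : EuclideanSpace ℝ Gᶜ.edgeSet} {i j : V}
    (h : (augmentedGraph G y).Adj i j) : totalMatrix G y i j = 1 := by
  rw [totalMatrix, Matrix.add_apply, SimpleGraph.adjMatrix_apply, inducedMatrix, Matrix.of_apply]
  rcases augmentedGraph_adj.1 h with h | ⟨h, h1⟩
  · have h' : ¬ s(i, j) ∈ Gᶜ.edgeSet := fun h' =>
      ((SimpleGraph.compl_adj _ _ _).1 ((SimpleGraph.mem_edgeSet _).1 h')).2 h
    rw [if_pos h, dif_neg h', add_zero]
  · have h' : ¬ G.Adj i j :=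
      ((SimpleGraph.compl_adj _ _ _).1 ((SimpleGraph.mem_edgeSet _).1 h)).2
    rw [if_neg h', dif_pos h, h1, zero_add]

theorem totalMatrix_apply_of_not_adj {y : EuclideanSpace ℝ Gᶜ.edgeSet}
    (hy : ∀ e, y e = 0 ∨ y e = 1) {i j : V}
    (h : ¬ (augmentedGraph G y).Adj i j) : totalMatrix G y i j = 0 := by
  rw [augmentedGraph_adj, not_or] at h
  rw [totalMatrix, Matrix.add_apply, SimpleGraph.adjMatrix_apply, inducedMatrix, Matrix.of_apply,
    if_neg h.1, zero_add]
  split_ifs with h'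
  · exact (hy _).resolve_right fun h1 => h.2 ⟨h', h1⟩
  · rfl

section Clique

variable {y : EuclideanSpace ℝ Gᶜ.edgeSet} (hy : ∀ e, y e = 0 ∨ y e = 1) {K : Set V}
  (hK : (augmentedGraph G y).IsClique K)

include hy hK

/-- Restricted to a clique, `A_G + A(y)` is the all-ones matrix minus the identity. -/
theorem totalMatrix_mulVec_apply {u : V → ℝ} (hu : Function.support u ⊆ K) {i : V} (hi : i ∈ K) :
    (totalMatrix G y).mulVec u i = ∑ j, u j - u i := by
  have : ∀ j, totalMatrix G y i j * u j = u j - if j = i then u j else 0 := fun j => by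
    by_cases h0 : u j = 0
    · simp [h0]
    by_cases hij : j = i
    · subst hij
      rw [totalMatrix_apply_of_not_adj hy (SimpleGraph.irrefl _), if_pos rfl, zero_mul, sub_self]
    · rw [totalMatrix_apply_of_adj (hK hi (hu h0) (Ne.symm hij)), if_neg hij, one_mul, sub_zero]
  rw [Matrix.mulVec, dotProduct, Finset.sum_congr rfl fun j _ => this j, Finset.sum_sub_distrib]
  simp

theorem dotProduct_totalMatrix_mulVec {u x : V → ℝ} (hu : Function.support u ⊆ K)
    (hx : Function.support x ⊆ K) :
    u ⬝ᵥ (totalMatrix G y).mulVec x = (∑ i, u i) * ∑ i, x i - u ⬝ᵥ x := by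
  rw [dotProduct, dotProduct, Finset.sum_mul, ← Finset.sum_sub_distrib]
  refine Finset.sum_congr rfl fun i _ => ?_
  by_cases h0 : u i = 0
  · simp [h0]
  · rw [totalMatrix_mulVec_apply hy hK hx (hu h0)]
    ring

end Clique

theorem objective_add_smul_of_isClique {α β : ℝ} {z : Space G} (hy : ∀ e, z.snd e = 0 ∨ z.snd e = 1)
    {K : Set V} (hK : (augmentedGraph G z.snd).IsClique K)
    (hz : Function.support z.fst.ofLp ⊆ K) {u : EuclideanSpace ℝ V}
    (hu : Function.support u.ofLp ⊆ K) (hu0 : ∑ i, u i = 0) (t : ℝ) :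
    objective G α β (z + t • fstDir G u) = objective G α β z
      + t * (-((2 - α) * (z.fst.ofLp ⬝ᵥ u.ofLp))) + t ^ 2 * (-((1 - α / 2) * ‖u‖ ^ 2)) := by
  rw [objective_add_smul_fstDir, dotProduct_totalMatrix_mulVec hy hK hu hz,
    dotProduct_totalMatrix_mulVec hy hK hu hu, hu0, norm_sq_eq_dotProduct,
    dotProduct_comm u.ofLp z.fst.ofLp]
  ring

namespace IsStrictLocalMaximizer

variable {s : ℕ} {α β : ℝ} {p : Space G}
  (hmax : IsStrictLocalMaximizer (objective G α β) (feasibleSet G s) p)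

include hmax

/-- Edge directions have positive curvature. Two fractional coordinates could be exchanged both
ways; a single one could move alone, since the budget `s` is an integer and hence not exhausted. -/
theorem snd_eq_zero_or_one (hβ : 0 < β) (e : Gᶜ.edgeSet) : p.snd e = 0 ∨ p.snd e = 1 := by
  obtain ⟨-, -, hy, hys⟩ := mem_feasibleSet.1 hmax.1
  by_contra! he
  have he0 : 0 < p.snd e := lt_of_le_of_ne (hy e).1 he.1.symm
  have he1 : p.snd e < 1 := lt_of_le_of_ne (hy e).2 he.2
  by_cases h : ∃ e', e ≠ e' ∧ 0 < p.snd e' ∧ p.snd e' < 1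
  · obtain ⟨e', hne, he0', he1'⟩ := h
    obtain ⟨ε, hε, hlt⟩ := exists_between (show (0 : ℝ) <
      min (min (p.snd e) (1 - p.snd e)) (min (p.snd e') (1 - p.snd e')) by
        simp only [lt_min_iff, sub_pos]; tauto)
    simp only [lt_min_iff] at hlt
    obtain ⟨⟨l1, l2⟩, l3, l4⟩ := hlt
    refine hmax.not_two_sided (convex_feasibleSet G s)
      (sndDir_ne_zero G (exchangeDir_ne_zero hne)) hε
      (add_smul_sndDir_exchangeDir_mem hmax.1 hne ?_ ?_ ?_ ?_)
      (add_smul_sndDir_exchangeDir_mem hmax.1 hne ?_ ?_ ?_ ?_) ?_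
      (objective_add_smul_sndDir G α β p _)
    any_goals linarith
    rw [exchangeDir_dotProduct_self hne]
    linarith
  · push Not at h
    have hbin : ∀ e' ∈ Finset.univ.erase e, p.snd e' = if p.snd e' = 1 then 1 else 0 := by
      intro e' he'
      split_ifs with h1
      · exact h1
      · by_contra h0
        exact h1 (le_antisymm (hy e').2 (h e' (Finset.ne_of_mem_erase he').symm
          (lt_of_le_of_ne (hy e').1 (Ne.symm h0))))
    have hsum := Finset.add_sum_erase Finset.univ (fun k => p.snd k) (Finset.mem_univ e)
    rw [Finset.sum_congr rfl hbin, Finset.sum_boole] at hsum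
    set n := ((Finset.univ.erase e).filter fun k => p.snd k = 1).card
    -- From `n + y_e ≤ s` and `y_e > 0`; integrality then gives `n + 1 ≤ s`, so `y_e` may grow up to
    -- `1`.
    have hn : n < s := by
      have : (n : ℝ) < s := by linarith
      exact_mod_cast this
    have hn1 : (n : ℝ) + 1 ≤ s := by exact_mod_cast hn
    obtain ⟨ε, hε, hlt⟩ := exists_between (show (0 : ℝ) < min (p.snd e) (1 - p.snd e) by
      simp only [lt_min_iff, sub_pos]; tauto)
    simp only [lt_min_iff] at hlt
    refine hmax.not_two_sided (convex_feasibleSet G s)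
      (sndDir_ne_zero G (v := EuclideanSpace.single e 1) (by simp)) hε
      (add_smul_sndDir_single_mem hmax.1 ?_ ?_ ?_)
      (add_smul_sndDir_single_mem hmax.1 ?_ ?_ ?_) ?_
      (objective_add_smul_sndDir G α β p _)
    any_goals linarith
    rw [single_dotProduct_eq]
    simpa using (half_pos hβ).le

theorem dotProduct_inducedMatrix_nonneg (e : Gᶜ.edgeSet) :
    0 ≤ p.fst.ofLp ⬝ᵥ (inducedMatrix G (EuclideanSpace.single e 1)).mulVec p.fst.ofLp := by
  have hx := (mem_feasibleSet.1 hmax.1).1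
  refine dotProduct_nonneg_of_nonneg hx fun i => ?_
  refine dotProduct_nonneg_of_nonneg (fun j => ?_) hx
  rw [inducedMatrix, Matrix.of_apply]
  split_ifs with h
  · rw [PiLp.single_apply]
    split_ifs <;> norm_num
  · exact le_rfl

/-- With unused budget some coordinate is `0`, and raising it has nonnegative slope and positive
curvature. -/
theorem sum_snd_eq (hβ : 0 < β) (hs : s ≤ Fintype.card Gᶜ.edgeSet) : ∑ e, p.snd e = s := by
  obtain ⟨-, -, hy, hys⟩ := mem_feasibleSet.1 hmax.1
  by_contra hne
  have hlt : ∑ e, p.snd e < s := lt_of_le_of_ne hys hne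
  obtain ⟨e, he⟩ : ∃ e, p.snd e = 0 := by
    by_contra! h
    have : ∀ e, p.snd e = 1 := fun e => (hmax.snd_eq_zero_or_one hβ e).resolve_left (h e)
    simp only [this, Finset.sum_const, Finset.card_univ, nsmul_eq_mul, mul_one] at hlt
    exact absurd hs (not_le.2 (by exact_mod_cast hlt))
  obtain ⟨ε, hε, hε1⟩ := exists_between (show (0 : ℝ) < min 1 (s - ∑ e, p.snd e) by
    simp [hlt])
  simp only [lt_min_iff] at hε1
  have h1 := (hmax.expansion (convex_feasibleSet G s)
    (sndDir_ne_zero G (v := EuclideanSpace.single e 1) (by simp)) hε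
    (add_smul_sndDir_single_mem hmax.1 (by linarith) (by linarith) (by linarith))
    (objective_add_smul_sndDir G α β p _)).2 (by
      rw [single_dotProduct_eq]
      simpa using (half_pos hβ).le)
  rw [single_dotProduct_eq, he, mul_zero, add_zero] at h1
  exact absurd h1 (not_lt.2 (hmax.dotProduct_inducedMatrix_nonneg e))

/-- For nonadjacent `i`, `j` in the support the matrix form vanishes on `e_i - e_j`, leaving
curvature `α > 0` in a two-sided feasible direction. -/
theorem isClique_support (hα : 0 < α) (hβ : 0 < β) :
    (augmentedGraph G p.snd).IsClique (Function.support p.fst.ofLp) := by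
  have hx := (mem_feasibleSet.1 hmax.1).1
  have hy := hmax.snd_eq_zero_or_one hβ
  intro i hi j hj hne
  by_contra hadj
  have hi0 : 0 < p.fst i := lt_of_le_of_ne (hx i) (Ne.symm hi)
  have hj0 : 0 < p.fst j := lt_of_le_of_ne (hx j) (Ne.symm hj)
  obtain ⟨ε, hε, hlt⟩ := exists_between (show (0 : ℝ) < min (p.fst i) (p.fst j) by simp [hi0, hj0])
  simp only [lt_min_iff] at hlt
  refine hmax.not_two_sided (convex_feasibleSet G s)
    (fstDir_ne_zero G (exchangeDir_ne_zero hne)) hε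
    (add_smul_fstDir_exchangeDir_mem hmax.1 hne ?_ ?_)
    (add_smul_fstDir_exchangeDir_mem hmax.1 hne ?_ ?_) ?_
    (objective_add_smul_fstDir G α β p _)
  any_goals linarith
  rw [exchangeDir_dotProduct_self hne, exchangeDir_dotProduct, ofLp_exchangeDir, Matrix.mulVec_sub,
    Matrix.mulVec_single_one, Matrix.mulVec_single_one]
  simp only [Pi.sub_apply, Matrix.col_apply]
  rw [totalMatrix_apply_of_not_adj hy (SimpleGraph.irrefl _),
    totalMatrix_apply_of_not_adj hy (SimpleGraph.irrefl _), totalMatrix_apply_of_not_adj hy hadj,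
    totalMatrix_apply_of_not_adj hy fun h => hadj h.symm]
  linarith

/-- For `u = x^(K) - x` the first order condition gives `⟨x, u⟩ ≥ 0`, while `⟨x^(K), u⟩ = 0` because
`u` has total mass zero on `K`; hence `‖u‖² ≤ 0`. The clique `K` may exceed the support, which is
what yields maximality. -/
theorem fst_eq_charVector (hα : α < 2) (hβ : 0 < β) {K : Finset V}
    (hK : (augmentedGraph G p.snd).IsClique (K : Set V))
    (hsupp : Function.support p.fst.ofLp ⊆ K) : p.fst = charVector K := by
  obtain ⟨hx, hx1, hyy⟩ := mem_feasibleSet.1 hmax.1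
  have hy := hmax.snd_eq_zero_or_one hβ
  have hne : K.Nonempty := by
    rw [Finset.nonempty_iff_ne_empty]
    rintro rfl
    rw [Finset.coe_empty, subset_empty_iff, Function.support_eq_empty_iff] at hsupp
    simp [hsupp] at hx1
  by_contra hpK
  set u := charVector K - p.fst with hu
  have hu0 : u ≠ 0 := sub_ne_zero.2 (Ne.symm hpK)
  have hus : Function.support u.ofLp ⊆ K := by
    rw [hu, WithLp.ofLp_sub]
    refine (Function.support_sub _ _).trans (union_subset ?_ hsupp)
    rw [support_charVector]
  have husum : ∑ i, u i = 0 := by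
    simp [hu, Finset.sum_sub_distrib, sum_charVector hne, hx1]
  have hpu : (p + (1 : ℝ) • fstDir G u).fst = charVector K := by
    rw [fst_add_smul_fstDir, one_smul, hu, add_sub_cancel]
  have h1 := (hmax.expansion (convex_feasibleSet G s) (fstDir_ne_zero G hu0) one_pos
    (mem_feasibleSet.2 ⟨fun i => by
      simpa only [hpu] using charVector_nonneg K i, by
      simpa only [hpu] using sum_charVector hne, by
      simpa only [snd_add_smul_fstDir] using hyy⟩)
    (objective_add_smul_of_isClique hy hK hsupp hus husum)).1
  have h2 : 0 ≤ p.fst.ofLp ⬝ᵥ u.ofLp := by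
    by_contra! h
    have := mul_neg_of_pos_of_neg (sub_pos.2 hα) h
    linarith
  have h3 : (charVector K).ofLp ⬝ᵥ u.ofLp = 0 := by
    rw [charVector_dotProduct hus, husum, mul_zero]
  have h4 : u.ofLp ⬝ᵥ u.ofLp ≤ 0 := by
    have : u.ofLp ⬝ᵥ u.ofLp = (charVector K).ofLp ⬝ᵥ u.ofLp - p.fst.ofLp ⬝ᵥ u.ofLp := by
      rw [← sub_dotProduct]; rfl
    linarith
  rw [← norm_sq_eq_dotProduct] at h4
  have := norm_pos_iff.2 hu0
  exact absurd h4 (not_le.2 (by positivity))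

theorem exists_maximal_isClique (hα : 0 < α) (hα' : α < 2) (hβ : 0 < β) :
    ∃ C : Finset V, C.Nonempty ∧
      Maximal (augmentedGraph G p.snd).IsClique (C : Set V) ∧ p.fst = charVector C := by
  classical
  have hC := hmax.isClique_support hα hβ
  have hK : ∀ K : Set V, (augmentedGraph G p.snd).IsClique K →
      Function.support p.fst.ofLp ⊆ K → p.fst = charVector K.toFinset := fun K h1 h2 =>
    hmax.fst_eq_charVector hα' hβ (by simpa using h1) (by simpa using h2)
  have hCp := hK _ hC Subset.rfl
  refine ⟨(Function.support p.fst.ofLp).toFinset, ?_, ⟨by simpa using hC, fun K hKc hle => ?_⟩, hCp⟩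
  · rw [Set.toFinset_nonempty, Function.support_nonempty_iff]
    intro h
    have := (mem_feasibleSet.1 hmax.1).2.1
    simp [h] at this
  · rw [Set.coe_toFinset] at hle ⊢
    rw [hK K hKc hle, support_charVector, Set.coe_toFinset]

end IsStrictLocalMaximizer

end Formulation

/-! ### The optimal face at `p` and its ascent system. -/

section Formulation

set_option linter.unusedSectionVars false

variable {V : Type*} [Fintype V] [DecidableEq V] {G : SimpleGraph V} [DecidableRel G.Adj]

variable (G) in
/-- The directions leading to the face `supp x ⊆ C`, `y_e = 1` for `e ∈ S`, `y_e = 0` for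
`e ∉ S`. -/
def ascentDirections (C : Finset V) (S : Set Gᶜ.edgeSet) : Set (Space G) :=
  image2 (fun i j => fstDir G (exchangeDir i j)) C (C : Set V)ᶜ ∪
    ((fun e => sndDir G (EuclideanSpace.single e 1)) '' S ∪
      image2 (fun e e' => sndDir G (exchangeDir e e')) S Sᶜ)

/-- By maximality `j` has a non-neighbour in `C`, whose weight `1/|C|` is lost. -/
theorem totalMatrix_mulVec_charVector_le {y : EuclideanSpace ℝ Gᶜ.edgeSet}
    (hy : ∀ e, y e = 0 ∨ y e = 1) {C : Finset V} (hC : C.Nonempty)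
    (hmax : Maximal (augmentedGraph G y).IsClique (C : Set V)) {j : V} (hj : j ∉ C) :
    (totalMatrix G y).mulVec (charVector C).ofLp j ≤ 1 - (C.card : ℝ)⁻¹ := by
  obtain ⟨k, hk, hjk⟩ : ∃ k ∈ C, ¬ (augmentedGraph G y).Adj j k := by
    by_contra! h
    have := hmax.2 (y := insert j (C : Set V))
      (SimpleGraph.isClique_insert.2 ⟨hmax.1, fun k hk _ => h k hk⟩) (subset_insert _ _)
    exact hj (this (mem_insert _ _))
  have hle : ∀ i, totalMatrix G y j i * charVector C i
      ≤ charVector C i - if i = k then charVector C i else 0 := fun i => by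
    have h0 := charVector_nonneg C i
    by_cases hik : i = k
    · rw [hik, totalMatrix_apply_of_not_adj hy hjk]
      simp
    · rw [if_neg hik, sub_zero]
      by_cases hij : (augmentedGraph G y).Adj j i
      · rw [totalMatrix_apply_of_adj hij, one_mul]
      · rwa [totalMatrix_apply_of_not_adj hy hij, zero_mul]
  calc _ ≤ ∑ i, (charVector C i - if i = k then charVector C i else 0) :=
        Finset.sum_le_sum fun i _ => hle i
    _ = 1 - (C.card : ℝ)⁻¹ := by
        rw [Finset.sum_sub_distrib, sum_charVector hC]
        simp [charVector_apply, hk]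

namespace IsStrictLocalMaximizer

variable {s : ℕ} {α β : ℝ} {p : Space G}
  (hmax : IsStrictLocalMaximizer (objective G α β) (feasibleSet G s) p)

include hmax

/-- A nonzero term would put both ends of `e` in the support, making them adjacent in `G(y)`,
although `e` is not an added edge. -/
theorem dotProduct_inducedMatrix_eq_zero (hα : 0 < α) (hβ : 0 < β) {e : Gᶜ.edgeSet}
    (he : p.snd e = 0) :
    p.fst.ofLp ⬝ᵥ (inducedMatrix G (EuclideanSpace.single e 1)).mulVec p.fst.ofLp = 0 := by
  rw [dotProduct]
  refine Finset.sum_eq_zero fun i _ => ?_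
  rw [Matrix.mulVec, dotProduct, Finset.mul_sum]
  refine Finset.sum_eq_zero fun j _ => ?_
  rw [inducedMatrix, Matrix.of_apply]
  split_ifs with h
  · rw [PiLp.single_apply]
    split_ifs with h1
    · by_contra hne
      have hi : p.fst i ≠ 0 := fun h0 => hne (by rw [h0, zero_mul])
      have hj : p.fst j ≠ 0 := fun h0 => hne (by rw [h0, mul_zero, mul_zero])
      have hadj := (SimpleGraph.compl_adj _ _ _).1 ((SimpleGraph.mem_edgeSet _).1 h)
      rcases augmentedGraph_adj.1 (hmax.isClique_support hα hβ hi hj hadj.1) with h2 | ⟨h2, h3⟩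
      · exact hadj.2 h2
      · rw [h1, he] at h3
        exact zero_ne_one h3
    · rw [zero_mul, mul_zero]
  · rw [zero_mul, mul_zero]

/-- The slopes are at least `α/|C|` for vertex exchanges and at least `β` for the two kinds of edge
directions. -/
theorem inner_gradient_pos (hα : 0 < α) (hβ : 0 < β) {C : Finset V}
    (hC : C.Nonempty) (hCmax : Maximal (augmentedGraph G p.snd).IsClique (C : Set V))
    (hp : p.fst = charVector C) {u : Space G}
    (hu : u ∈ ascentDirections G C {e | p.snd e = 1}) :
    0 < inner ℝ (gradient (objective G α β) p) u := by
  have hd := (contDiff_objective G α β).differentiable one_ne_zero p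
  have hy := hmax.snd_eq_zero_or_one hβ
  rcases hu with ⟨i, hi, j, hj, rfl⟩ | ⟨e, he, rfl⟩ | ⟨e, he, e', he', rfl⟩
  · rw [inner_gradient_eq hd (objective_add_smul_fstDir G α β p _), exchangeDir_dotProduct,
      exchangeDir_dotProduct]
    have h1 := totalMatrix_mulVec_charVector_le hy hC hCmax hj
    rw [hp, totalMatrix_mulVec_apply hy hCmax.1 (support_charVector C).subset hi,
      sum_charVector hC]
    have h2 : charVector C i = (C.card : ℝ)⁻¹ := by
      rw [charVector_apply, if_pos (by exact_mod_cast hi)]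
    have h3 : charVector C j = 0 := by
      rw [charVector_apply, if_neg fun h => hj (by exact_mod_cast h)]
    rw [h2, h3]
    have h4 : 0 < α * (C.card : ℝ)⁻¹ :=
      mul_pos hα (inv_pos.2 (by exact_mod_cast hC.card_pos))
    linarith
  · rw [inner_gradient_eq hd (objective_add_smul_sndDir G α β p _), single_dotProduct_eq,
      show p.snd e = 1 from he]
    linarith [hmax.dotProduct_inducedMatrix_nonneg e]
  · have he0 : p.snd e' = 0 := (hy e').resolve_right he'
    have hM : inducedMatrix G (exchangeDir e e') = inducedMatrix G (EuclideanSpace.single e 1)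
        + (-1 : ℝ) • inducedMatrix G (EuclideanSpace.single e' 1) := by
      rw [← inducedMatrix_add_smul, exchangeDir, neg_one_smul, sub_eq_add_neg]
    rw [inner_gradient_eq hd (objective_add_smul_sndDir G α β p _), exchangeDir_dotProduct,
      show p.snd e = 1 from he, he0, hM, Matrix.add_mulVec, Matrix.smul_mulVec, dotProduct_add,
      dotProduct_smul, hmax.dotProduct_inducedMatrix_eq_zero hα hβ he0, smul_zero]
    linarith [hmax.dotProduct_inducedMatrix_nonneg e]

/-- Mass outside `C` can be moved into `C`. Otherwise `y` differs from `y^(p)`, which exhausts the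
budget, so some selected edge is below `1`: it is raised if budget remains, and otherwise takes
weight from an unselected edge. -/
theorem exists_ascentDirection (hβ : 0 < β) (hs : s ≤ Fintype.card Gᶜ.edgeSet) {C : Finset V}
    (hC : C.Nonempty) {z : Space G} (hz : z ∈ feasibleSet G s)
    (hzF : ¬ (Function.support z.fst.ofLp ⊆ C ∧ z.snd = p.snd)) :
    ∃ u ∈ ascentDirections G C {e | p.snd e = 1}, ∃ t : ℝ, 0 < t ∧ z + t • u ∈ feasibleSet G s := by
  have hpy := hmax.snd_eq_zero_or_one hβ
  obtain ⟨hx, -, hy, hys⟩ := mem_feasibleSet.1 hz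
  by_cases hsupp : Function.support z.fst.ofLp ⊆ C
  swap
  · obtain ⟨j, hj, hjC⟩ := not_subset.1 hsupp
    obtain ⟨i, hi⟩ := hC
    have hne : i ≠ j := fun h => hjC (h ▸ hi)
    exact ⟨_, Or.inl ⟨i, hi, j, hjC, rfl⟩, z.fst j, lt_of_le_of_ne (hx j) (Ne.symm hj),
      add_smul_fstDir_exchangeDir_mem hz hne (add_nonneg (hx i) (hx j)) (sub_self _).ge⟩
  have hps : ∑ e, p.snd e = s := hmax.sum_snd_eq hβ hs
  have hne : z.snd ≠ p.snd := fun h => hzF ⟨hsupp, h⟩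
  obtain ⟨e, he, he1⟩ : ∃ e, p.snd e = 1 ∧ z.snd e < 1 := by
    by_contra! h
    have hle : ∀ e ∈ Finset.univ, p.snd e ≤ z.snd e := fun e _ => by
      rcases hpy e with h0 | h1
      · exact h0 ▸ (hy e).1
      · exact h1 ▸ h e h1
    have heq := (Finset.sum_eq_sum_iff_of_le hle).1
      (le_antisymm (Finset.sum_le_sum hle) (hps ▸ hys))
    exact hne (PiLp.ext fun e => (heq e (Finset.mem_univ e)).symm)
  rcases hys.lt_or_eq with hlt | heq
  · obtain ⟨t, ht, ht'⟩ := exists_between (show (0 : ℝ) < min (1 - z.snd e) (s - ∑ e, z.snd e) by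
      simp [he1, hlt])
    simp only [lt_min_iff] at ht'
    exact ⟨_, Or.inr (Or.inl ⟨e, he, rfl⟩), t, ht, add_smul_sndDir_single_mem hz
      (by linarith [(hy e).1]) (by linarith) (by linarith)⟩
  · obtain ⟨e', he', he0⟩ : ∃ e', p.snd e' ≠ 1 ∧ 0 < z.snd e' := by
      by_contra! h
      have hle : ∀ e ∈ Finset.univ, z.snd e ≤ p.snd e := fun e _ => by
        rcases hpy e with h0 | h1
        · exact h0 ▸ h e (by rw [h0]; exact zero_ne_one)
        · exact h1 ▸ (hy e).2
      have heq := (Finset.sum_eq_sum_iff_of_le hle).1 (heq.trans hps.symm)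
      exact hne (PiLp.ext fun e => heq e (Finset.mem_univ e))
    have hee : e ≠ e' := fun h => he' (h ▸ he)
    obtain ⟨t, ht, ht'⟩ := exists_between (show (0 : ℝ) < min (1 - z.snd e) (z.snd e') by
      simp [he1, he0])
    simp only [lt_min_iff] at ht'
    exact ⟨_, Or.inr (Or.inr ⟨e, he, e', he', rfl⟩), t, ht, add_smul_sndDir_exchangeDir_mem hz hee
      (by linarith [(hy e).1]) (by linarith) (by linarith) (by linarith [(hy e').2])⟩

/-- Coordinates lowered by `-u` are near `1/|C|` or `1`, and raised edge coordinates are near `0`,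
so half of these values is a safe step. -/
theorem exists_opposite_step (hβ : 0 < β) {C : Finset V}
    (hp : p.fst = charVector C) {u : Space G}
    (hu : u ∈ ascentDirections G C {e | p.snd e = 1}) :
    ∃ τ : ℝ, 0 < τ ∧ ∀ᶠ z in 𝓝[feasibleSet G s] p, z - τ • u ∈ feasibleSet G s := by
  have hy := hmax.snd_eq_zero_or_one hβ
  have hx : ∀ i, Tendsto (fun z : Space G => z.fst i) (𝓝[feasibleSet G s] p) (𝓝 (p.fst i)) :=
    fun i => ((fstCoord G i).continuous.tendsto p).mono_left nhdsWithin_le_nhds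
  have hyt : ∀ e, Tendsto (fun z : Space G => z.snd e) (𝓝[feasibleSet G s] p) (𝓝 (p.snd e)) :=
    fun e => ((sndCoord G e).continuous.tendsto p).mono_left nhdsWithin_le_nhds
  rcases hu with ⟨i, hi, j, hj, rfl⟩ | ⟨e, he, rfl⟩ | ⟨e, he, e', he', rfl⟩
  · have hne : i ≠ j := fun h => hj (h ▸ hi)
    have hi0 : 0 < p.fst i := by
      have : (C.card : ℝ) ≠ 0 := by
        exact_mod_cast (Finset.card_pos.2 ⟨i, by exact_mod_cast hi⟩).ne'
      rw [hp, charVector_apply, if_pos (by exact_mod_cast hi)]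
      positivity
    refine ⟨p.fst i / 2, half_pos hi0, ?_⟩
    filter_upwards [(hx i).eventually_const_lt (half_lt_self hi0), self_mem_nhdsWithin]
      with z hz hzQ
    rw [sub_eq_add_neg, ← neg_smul]
    exact add_smul_fstDir_exchangeDir_mem hzQ hne (by linarith)
      (by linarith [(mem_feasibleSet.1 hzQ).1 j])
  · have he : p.snd e = 1 := he
    refine ⟨1 / 2, by norm_num, ?_⟩
    filter_upwards [(hyt e).eventually_const_lt (show (1 / 2 : ℝ) < p.snd e by norm_num [he]),
      self_mem_nhdsWithin] with z hz hzQ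
    obtain ⟨-, -, h1, h2⟩ := mem_feasibleSet.1 hzQ
    rw [sub_eq_add_neg, ← neg_smul]
    exact add_smul_sndDir_single_mem hzQ (by linarith) (by linarith [(h1 e).2]) (by linarith)
  · have hne : e ≠ e' := fun h => he' (h ▸ he)
    have he : p.snd e = 1 := he
    have he' : p.snd e' = 0 := (hy e').resolve_right he'
    refine ⟨1 / 2, by norm_num, ?_⟩
    filter_upwards [(hyt e).eventually_const_lt (show (1 / 2 : ℝ) < p.snd e by norm_num [he]),
      (hyt e').eventually_lt_const (show p.snd e' < (1 / 2 : ℝ) by norm_num [he']),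
      self_mem_nhdsWithin] with z hz hz' hzQ
    obtain ⟨-, -, h1, -⟩ := mem_feasibleSet.1 hzQ
    rw [sub_eq_add_neg, ← neg_smul]
    exact add_smul_sndDir_exchangeDir_mem hzQ hne (by linarith) (by linarith [(h1 e).2])
      (by linarith [(h1 e').1]) (by linarith)

/-- The linear term vanishes because `x^(C)` is orthogonal to vectors of total mass zero on `C`. -/
theorem objective_add_smul_sub (hβ : 0 < β) {C : Finset V}
    (hCmax : (augmentedGraph G p.snd).IsClique (C : Set V))
    (hp : p.fst = charVector C) {z : Space G} (hz : z ∈ feasibleSet G s)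
    (hsupp : Function.support z.fst.ofLp ⊆ C) (hsnd : z.snd = p.snd) (t : ℝ) :
    objective G α β (p + t • (z - p)) =
      objective G α β p + t * 0 + t ^ 2 * (-((1 - α / 2) * ‖z - p‖ ^ 2)) := by
  have hy := hmax.snd_eq_zero_or_one hβ
  have hsp : Function.support p.fst.ofLp ⊆ C := by rw [hp, support_charVector]
  have hu : Function.support (z.fst - p.fst).ofLp ⊆ C :=
    (Function.support_sub _ _).trans (union_subset hsupp hsp)
  have hu0 : ∑ i, (z.fst - p.fst) i = 0 := by
    simp [Finset.sum_sub_distrib, (mem_feasibleSet.1 hz).2.1, (mem_feasibleSet.1 hmax.1).2.1]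
  have hdir : z - p = fstDir G (z.fst - p.fst) := by
    rw [fstDir, ← sub_self p.snd]
    nth_rw 1 [← hsnd]
    rfl
  have hnorm : ‖z - p‖ ^ 2 = ‖z.fst - p.fst‖ ^ 2 := by
    rw [WithLp.prod_norm_sq_eq_of_L2, hdir]
    simp [fstDir]
  have hdot : p.fst.ofLp ⬝ᵥ (z.fst - p.fst).ofLp = 0 := by
    nth_rw 1 [hp]
    rw [charVector_dotProduct hu, hu0, mul_zero]
  rw [hnorm, hdir, objective_add_smul_of_isClique hy hCmax hsp hu hu0, hdot, mul_zero, neg_zero]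

/-- From a point of the optimal face violating the right side, an ascent direction would push the
linearization above its maximum; conversely the linear term towards such points is zero. -/
theorem mem_optimalFace_iff (hα : 0 < α) (hβ : 0 < β) (hs : s ≤ Fintype.card Gᶜ.edgeSet)
    {C : Finset V} (hC : C.Nonempty)
    (hCmax : Maximal (augmentedGraph G p.snd).IsClique (C : Set V))
    (hp : p.fst = charVector C) {z : Space G} (hz : z ∈ feasibleSet G s) :
    z ∈ optimalFace (objective G α β) (feasibleSet G s) p ↔
      Function.support z.fst.ofLp ⊆ C ∧ z.snd = p.snd := by
  have hd := (contDiff_objective G α β).differentiable one_ne_zero p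
  refine ⟨fun h => ?_, fun h => ⟨hz, ?_⟩⟩
  · by_contra hzF
    obtain ⟨u, hu, t, ht, hut⟩ := hmax.exists_ascentDirection hβ hs hC hz hzF
    have h1 := hmax.inner_gradient_nonpos (convex_feasibleSet G s) hd _ hut
    have h2 := mul_pos ht (hmax.inner_gradient_pos hα hβ hC hCmax hp hu)
    rw [inner_sub_right, inner_add_right, inner_smul_right, h.2] at h1
    linarith
  · have := inner_gradient_eq hd (hmax.objective_add_smul_sub hβ hCmax.1 hp hz h.1 h.2)
    rwa [inner_sub_right, sub_eq_zero] at this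

theorem isAscentSystem (hα : 0 < α) (hβ : 0 < β) (hs : s ≤ Fintype.card Gᶜ.edgeSet)
    {C : Finset V} (hC : C.Nonempty)
    (hCmax : Maximal (augmentedGraph G p.snd).IsClique (C : Set V))
    (hp : p.fst = charVector C) :
    IsAscentSystem (objective G α β) (feasibleSet G s) p
      (ascentDirections G C {e | p.snd e = 1}) where
  finite := (Set.Finite.image2 _ (toFinite _) (toFinite _)).union
    (((toFinite _).image _).union (Set.Finite.image2 _ (toFinite _) (toFinite _)))
  pos _ := hmax.inner_gradient_pos hα hβ hC hCmax hp
  feasible _ hy hyF := hmax.exists_ascentDirection hβ hs hC hy fun h =>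
    hyF ((hmax.mem_optimalFace_iff hα hβ hs hC hCmax hp hy).2 h)
  opposite _ := hmax.exists_opposite_step hβ hp

end IsStrictLocalMaximizer

end Formulation

end DefectiveClique

end

/-! ### Assembly of the main theorem. -/

theorem mainTheorem8 {V : Type*} [Fintype V] [DecidableEq V]
    (G : SimpleGraph V) [DecidableRel G.Adj]
    (s : ℕ) (hs : s ≤ Fintype.card Gᶜ.edgeSet)
    (α β : ℝ) (hα : 0 < α) (hα' : α < 2) (hβ : 0 < β)
    (z t v d : ℕ → DefectiveClique.Space G) (a : ℕ → ℝ)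
    (hz : DefectiveClique.IsFDFW (DefectiveClique.objective G α β)
      (DefectiveClique.feasibleSet G s) z t v d a)
    (c ρ : ℝ) (hc : 0 < c) (hρ : 0 < ρ)
    (hS1 : DefectiveClique.StepCondition (DefectiveClique.objective G α β)
      (DefectiveClique.feasibleSet G s) c z d a)
    (hS2 : DefectiveClique.IncreaseCondition (DefectiveClique.objective G α β)
      (DefectiveClique.feasibleSet G s) c ρ z d a)
    (p : DefectiveClique.Space G) (hp : MapClusterPt p atTop z)
    (hmax : DefectiveClique.IsStrictLocalMaximizer (DefectiveClique.objective G α β)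
      (DefectiveClique.feasibleSet G s) p) :
    ∃ C : Finset V, C.Nonempty ∧ p.snd ∈ DefectiveClique.fakeEdges G s ∧
      Maximal (DefectiveClique.augmentedGraph G p.snd).IsClique (C : Set V) ∧
      p.fst = DefectiveClique.charVector C ∧
      Tendsto z atTop (𝓝 p) ∧
      ∀ᶠ k in atTop, Function.support (z k).fst.ofLp ⊆ (C : Set V) ∧ (z k).snd = p.snd := by
  open DefectiveClique in
  obtain ⟨C, hC, hCmax, hpC⟩ := hmax.exists_maximal_isClique hα hα' hβ
  have hface := fun {w} (hw : w ∈ feasibleSet G s) =>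
    hmax.mem_optimalFace_iff hα hβ hs hC hCmax hpC hw
  have hD := hmax.isAscentSystem hα hβ hs hC hCmax hpC
  have hsmooth := contDiff_objective G α β
  have hopt := hmax.inner_gradient_nonpos (convex_feasibleSet G s)
    (hsmooth.differentiable one_ne_zero p)
  have hconc : ∀ y ∈ optimalFace (objective G α β) (feasibleSet G s) p,
      objective G α β y = objective G α β p - (1 - α / 2) * ‖y - p‖ ^ 2 := fun y hy => by
    obtain ⟨h1, h2⟩ := (hface hy.1).1 hy
    -- At `t = 1` the expansion gives the decay constant `κ = 1 - α/2`, positive since `α < 2`.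
    have := hmax.objective_add_smul_sub hβ hCmax.1 hpC hy.1 h1 h2 1
    rw [one_smul, add_sub_cancel] at this
    rw [this]
    ring
  have hcompact := isCompact_feasibleSet G s
  have key : Tendsto z atTop (𝓝 p) ∧
      ∀ᶠ k in atTop, z k ∈ optimalFace (objective G α β) (feasibleSet G s) p := by
    rw [feasibleSet_eq_polyhedron] at *
    exact hz.tendsto_and_eventually_mem_optimalFace hcompact (continuous_gradient hsmooth) hopt hD
      hc hρ hS1 hS2 (by linarith) hconc hp
  exact ⟨C, hC, ⟨hmax.snd_eq_zero_or_one hβ, (mem_feasibleSet.1 hmax.1).2.2.2⟩, hCmax, hpC, key.1,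
    key.2.mono fun k hk => (hface hk.1).1 hk⟩
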